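/- Fix $q>3$, $M>0$ and $\alpha\in(0,1)$. Put $z(x)=\sum_{n\ge1}n^{-x}$, $a_1=(2+4/q)^qM$, $a_2=\tfrac12(q+2)^{-2}e^{-q}M^{-2/q}$, and let \[ f(n)=\max\left\{\left(\frac{2a_1z(2)}{\alpha\, n^{q-3}}\right)^{1/q},\ \sqrt{\frac{\log(2z(3))+3\log n+\log(1/\alpha)}{a_2n}}\right\},\qquad n\ge1 . \] For every $k\ge 1$ consider $k$ alternatives. From alternative $i$ one can draw i.i.d. observations $X_{i,1},X_{i,2},\dots$ distributed as $X_i$, with mean $\mu_i$, independently across alternatives. Write $\bar X_i(n)$ for the mean of the first $n$ of them, $U_i(n)=\bar X_i(n)+f(n)$, and $U_1^*=\inf_{n\ge1}U_1(n)$. The meta-UCB algorithm with budget $B$ takes one observation from each alternative; then, as long as the total sample size $\sum_i n_i$ is less than $B$, it takes one more observation from an alternative $i$ that maximizes $U_i(n_i)$, where $n_i$ is the current sample size of $i$; finally it outputs an alternative with the largest sample size. Ties are broken by arbitrary fixed (measurable) rules. Let $\mathrm{PCS}$ be the probability that the output is alternative $1$. There are positive constants $d_0,d_1,d_2,d_3$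 depending only on $q,M,\alpha$ such that the following holds for every $\beta$ with $0\le\beta<\min\{(q-3)/q,\,1/2\}$. Suppose that for every $k$ each $X_i$ ($1\le i\le k$) has a continuous distribution with $\mathrm{E}|X_i|^q\le M$, that the distribution of $X_1$ (with mean $\mu_1$) does not depend on $k$, and that $\mu_i=\mu_1-(i/k)^\beta$ for $i=2,\dots,k$; the distributions of the other alternatives may otherwise depend on $k$. Then, with total sampling budget \[ B=\left[d_0+\frac{d_1}{1-\beta q/(q-3)}+\frac{d_2}{1-2\beta}+\frac{d_3\,\beta}{(1-2\beta)^2}\right]k , \] one has \[ \liminf_{k\to\infty}\mathrm{PCS}\ \ge\ \Pr\{U_1^*\ge\mu_1\}\ >\ 0 . \] -/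

import Mathlib

open MeasureTheory ProbabilityTheory Filter

noncomputable section

namespace MetaUCB

/-! ### The exploration bonus -/

/-- `z(x) = ∑_{n ≥ 1} 1 / n ^ x`. -/
def zetaSum (x : ℝ) : ℝ := ∑' n : ℕ, 1 / ((n : ℝ) + 1) ^ x

/-- `a₁ = (2 + 4 / q) ^ q * M`. -/
def a₁ (q M : ℝ) : ℝ := (2 + 4 / q) ^ q * M

/-- `a₂ = (q + 2) ^ (-2) * e ^ (-q) * M ^ (-2 / q) / 2`. -/
def a₂ (q M : ℝ) : ℝ := (q + 2) ^ (-2 : ℝ) * Real.exp (-q) * M ^ (-2 / q) / 2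

/-- The moment-based exploration bonus with parameters `q, M, α` and `q'`, as a function of the
sample size `n ≥ 1` (the value at `n = 0` is never used). -/
def bonus (q M α q' : ℝ) (n : ℕ) : ℝ :=
  max ((2 * a₁ q M * zetaSum q' / (α * (n : ℝ) ^ (q - 1 - q'))) ^ (1 / q))
    (Real.sqrt ((Real.log (2 * zetaSum (q' + 1)) + (q' + 1) * Real.log n + Real.log (1 / α))
      / (a₂ q M * n)))

/-! ### UCB values -/

/-- The sample mean of the first `n` observations `x 0, …, x (n - 1)`. -/
def sampleMean (x : ℕ → ℝ) (n : ℕ) : ℝ := (∑ j ∈ Finset.range n, x j) / n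

/-- The UCB value after `n` observations, for the bonus function `f`. -/
def ucb (f : ℕ → ℝ) (x : ℕ → ℝ) (n : ℕ) : ℝ := sampleMean x n + f n

/-- The infimum over all `n ≥ 1` of the UCB value process (extended-real valued). -/
def ucbInf (f : ℕ → ℝ) (x : ℕ → ℝ) : EReal := ⨅ n : ℕ, ⨅ _ : 1 ≤ n, ((ucb f x n : ℝ) : EReal)

/-! ### The meta-UCB algorithm -/

/-- A rule that picks a maximizer of a real vector, breaking ties in an arbitrary measurable way. -/
structure ArgmaxRule (ι : Type*) where
  /-- the index that is picked -/
  pick : (ι → ℝ) → ι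
  le_pick : ∀ (v : ι → ℝ) (i : ι), v i ≤ v (pick v)
  measurableSet_pick : ∀ i : ι, MeasurableSet {v : ι → ℝ | pick v = i}

section Algorithm

variable {ι : Type*} [Fintype ι] [DecidableEq ι]

/-- The sample sizes after `t` rounds of the loop of the meta-UCB algorithm with budget `B`, where
`U i n` is the UCB value of alternative `i` after `n` observations. At the start every alternative
has been sampled once. As long as the total sample size is below `B`, one more observation is taken
from an alternative with the largest current UCB value; afterwards nothing changes. -/
def counts (rule : ArgmaxRule ι) (U : ι → ℕ → ℝ) (B : ℝ) : ℕ → ι → ℕ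
  | 0 => fun _ => 1
  | t + 1 =>
    let n := counts rule U B t
    if ((∑ i, n i : ℕ) : ℝ) < B then
      let s := rule.pick (fun i => U i (n i))
      Function.update n s (n s + 1)
    else n

/-- The sample sizes `n_i(B)` when the loop has ended; each round before the end adds one
observation, so that the loop has ended after at most `⌈B⌉` rounds. -/
def finalCounts (rule : ArgmaxRule ι) (U : ι → ℕ → ℝ) (B : ℝ) : ι → ℕ :=
  counts rule U B ⌈B⌉₊

/-- The output of the meta-UCB algorithm: an alternative with the largest final sample size, ties
being broken by `out`. -/
def output (rule out : ArgmaxRule ι) (U : ι → ℕ → ℝ) (B : ℝ) : ι :=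
  out.pick (fun i => (finalCounts rule U B i : ℝ))

/-- The loop has indeed ended after `⌈B⌉` rounds: the budget is exhausted. -/
theorem le_sum_finalCounts (rule : ArgmaxRule ι) (U : ι → ℕ → ℝ) (B : ℝ) :
    B ≤ ((∑ i, finalCounts rule U B i : ℕ) : ℝ) := by
  have key : ∀ t : ℕ, B ≤ ((∑ i, counts rule U B t i : ℕ) : ℝ) ∨
      t ≤ ∑ i, counts rule U B t i := by
    intro t
    induction t with
    | zero => exact Or.inr (Nat.zero_le _)
    | succ t ih =>
      by_cases h : ((∑ i, counts rule U B t i : ℕ) : ℝ) < B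
      · right
        have ht : t ≤ ∑ i, counts rule U B t i := ih.resolve_left (not_le.mpr h)
        simp only [counts, if_pos h]
        rw [Finset.sum_update_of_mem (Finset.mem_univ _)]
        have := Finset.add_sum_erase Finset.univ (counts rule U B t)
          (Finset.mem_univ (rule.pick fun i => U i (counts rule U B t i)))
        rw [Finset.sdiff_singleton_eq_erase]
        omega
      · left
        simp only [counts, if_neg h]
        exact not_lt.mp h
  rcases key ⌈B⌉₊ with h | h
  · exact h
  · exact (Nat.le_ceil B).trans (by exact_mod_cast h)

end Algorithm

/-! ### Sampling model and moment condition -/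

section Model

variable {Ω : Type*} [MeasurableSpace Ω] {ι : Type*}

/-- `X i j` is the `(j + 1)`-st observation of alternative `i`: the observations of each alternative
are i.i.d., and observations of different alternatives are independent. -/
structure IsSamplingModel (P : Measure Ω) (X : ι → ℕ → Ω → ℝ) : Prop where
  measurable : ∀ i j, Measurable (X i j)
  identDistrib : ∀ i j, IdentDistrib (X i j) (X i 0) P P
  indep : iIndepFun (fun p : ι × ℕ => X p.1 p.2) P

/-- Every alternative has a continuous distribution (one without atoms) and a `q`-th absolute moment
of at most `M`. -/
structure MomentCondition (P : Measure Ω) (X : ι → ℕ → Ω → ℝ) (q M : ℝ) : Prop where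
  noAtoms : ∀ i, ∀ x : ℝ, P {ω | X i 0 ω = x} = 0
  integrable : ∀ i, Integrable (fun ω => |X i 0 ω| ^ q) P
  moment_le : ∀ i, ∫ ω, |X i 0 ω| ^ q ∂P ≤ M

/-- The probability that the meta-UCB algorithm with bonus function `f` and budget `B` outputs
the alternative `best`. -/
def PCS [Fintype ι] [DecidableEq ι] (P : Measure Ω) (X : ι → ℕ → Ω → ℝ) (f : ℕ → ℝ)
    (rule out : ArgmaxRule ι) (B : ℝ) (best : ι) : ENNReal :=
  P {ω | output rule out (fun i n => ucb f (fun j => X i j ω) n) B = best}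

end Model

end MetaUCB

end

noncomputable section

namespace MetaUCB

/-! ### Third moments of sums of independent centred variables -/

section ThirdMoment

/-! Work on the event that the UCB process of the best alternative never falls below its mean `μ₁`.
There an inferior alternative is sampled again at size `n` only if its own UCB value at `n` is at
least `μ₁`. Its final size is thus controlled by its own observations alone, through `overcount`,
and the adaptivity of the algorithm disappears. If the overcounts of the inferior alternatives sum
to less than half the budget, the best one holds more than half and is output
(`output_eq_of_overcount`).

For an alternative with gap `δ`, the bonus is at most `δ / 2` from a size `n₀` of order `δ ^ (-q /
(q - 3)) + δ ^ (-2) * (1 + log (1 / δ))` on. Beyond `n₀` a large UCB value forces a deviation of the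
sample mean by `δ / 2`, and third moments bound its probability by a summable `n ^ (-3 / 2)`
(`integral_overcount_le`). With `δ = (i / k) ^ β` the expected overcounts add up to a multiple of
`k`; the power sums produce the denominators in the budget.

Truncating at `L`, about `k ^ θ` with `θ < 1`, makes the overcounts bounded. They are independent
across alternatives, so Chebyshev's inequality gives concentration of their sum
(`measure_sum_overcount_ge_le`). The price is a union bound over UCB values still at least `μ₁` at
size `L`; both errors vanish for a suitable `θ`.

The event has positive probability (`measure_le_ucb_pos`): the bonus dominates a multiple of `√(log
n / n)`, so it suffices that finitely many initial observations are at least the mean and that the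
later sums stay inside an iterated-logarithm type boundary. Its probability depends only on the law
of one observation (`IsSamplingModel.measure_le_ucb_eq`), hence is the same for every `k`. -/

/-- Taylor expansion of `|·| ^ 3` at `x`. In expectation the term linear in `y` vanishes for an
independent centred `y`. -/
theorem abs_add_pow_three_le (x y : ℝ) :
    |x + y| ^ 3 ≤ |x| ^ 3 + 3 * (x * |x| * y) + 3 * (|x| * y ^ 2) + |y| ^ 3 := by
  rcases abs_cases x with ⟨hx, hx'⟩ | ⟨hx, hx'⟩ <;> rcases abs_cases y with ⟨hy, hy'⟩ | ⟨hy, hy'⟩ <;>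
    rcases abs_cases (x + y) with ⟨hz, hz'⟩ | ⟨hz, hz'⟩ <;> rw [hx, hy, hz]
  · nlinarith
  · linarith
  · nlinarith [pow_pos (neg_pos.2 hy') 3]
  -- The difference of the two sides is `2 * x * (x ^ 2 + 3 * x * y + 3 * y ^ 2)`, and four times
  -- the last factor is `(2 * x + 3 * y) ^ 2 + 3 * y ^ 2`.
  · nlinarith [mul_nonneg hx' (sq_nonneg (2 * x + 3 * y)), mul_nonneg hx' (sq_nonneg x),
      mul_nonneg hx' (sq_nonneg y)]
  · nlinarith [mul_nonneg (neg_pos.2 hx').le (sq_nonneg (2 * x + 3 * y)),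
      mul_nonneg (neg_pos.2 hx').le (sq_nonneg x), mul_nonneg (neg_pos.2 hx').le (sq_nonneg y)]
  · nlinarith [pow_nonneg hy' 3]
  · linarith
  · nlinarith

variable {Ω : Type*} [MeasurableSpace Ω]

/-- Independent centred variables with second and third absolute moments at most `s`. -/
structure IsCentredSeq (P : Measure Ω) (Y : ℕ → Ω → ℝ) (s : ℝ) : Prop where
  measurable : ∀ j, Measurable (Y j)
  indep : iIndepFun Y P
  memLp : ∀ j, MemLp (Y j) 3 P
  mean : ∀ j, ∫ ω, Y j ω ∂P = 0
  sq_le : ∀ j, ∫ ω, Y j ω ^ 2 ∂P ≤ s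
  cube_le : ∀ j, ∫ ω, |Y j ω| ^ 3 ∂P ≤ s
  one_le : 1 ≤ s

/-- The partial sums of a sequence of random variables. -/
def partialSum (Y : ℕ → Ω → ℝ) (n : ℕ) (ω : Ω) : ℝ := ∑ j ∈ Finset.range n, Y j ω

namespace IsCentredSeq

variable {P : Measure Ω} {Y : ℕ → Ω → ℝ} {s : ℝ}

theorem memLp_partialSum (h : IsCentredSeq P Y s) (n : ℕ) : MemLp (partialSum Y n) 3 P := by
  unfold partialSum
  exact memLp_finsetSum _ fun j _ => h.memLp j

theorem partialSum_succ {Ω : Type*} (Y : ℕ → Ω → ℝ) (n : ℕ) (ω : Ω) :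
    partialSum Y (n + 1) ω = partialSum Y n ω + Y n ω := by
  simp [partialSum, Finset.sum_range_succ]

theorem indepFun_partialSum (h : IsCentredSeq P Y s) (n : ℕ) :
    IndepFun (partialSum Y n) (Y n) P := by
  have := h.indep.indepFun_sum_range_succ h.measurable n
  convert this using 1
  ext ω; simp [partialSum]

theorem integrable_of_memLp_three {P : Measure Ω} [IsProbabilityMeasure P] {Z : Ω → ℝ}
    (hZ : MemLp Z 3 P) :
    Integrable Z P ∧ Integrable (fun ω => Z ω ^ 2) P ∧ Integrable (fun ω => |Z ω| ^ 3) P := by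
  refine ⟨hZ.integrable (by norm_num), (hZ.mono_exponent (by norm_num)).integrable_sq, ?_⟩
  simpa using hZ.integrable_norm_pow (p := 3) (by norm_num)

theorem integral_sq_partialSum_le (h : IsCentredSeq P Y s) (n : ℕ) :
    ∫ ω, partialSum Y n ω ^ 2 ∂P ≤ n * s := by
  have := h.indep.isProbabilityMeasure
  induction n with
  | zero => simp [partialSum]
  | succ n ih =>
    obtain ⟨i1, i2, -⟩ := integrable_of_memLp_three (h.memLp_partialSum n)
    obtain ⟨j1, j2, -⟩ := integrable_of_memLp_three (h.memLp n)
    have hind := h.indepFun_partialSum n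
    have i3 : Integrable (fun ω => partialSum Y n ω * Y n ω) P := hind.integrable_mul i1 j1
    have e : ∫ ω, partialSum Y n ω * Y n ω ∂P = 0 := by
      have := hind.integral_mul_eq_mul_integral i1.1 j1.1
      simp only [h.mean n, mul_zero] at this
      exact this
    have : ∫ ω, partialSum Y (n + 1) ω ^ 2 ∂P
        = ∫ ω, partialSum Y n ω ^ 2 ∂P + 2 * ∫ ω, partialSum Y n ω * Y n ω ∂P
          + ∫ ω, Y n ω ^ 2 ∂P := by
      have i4 : Integrable (fun ω => partialSum Y n ω ^ 2 + 2 * (partialSum Y n ω * Y n ω)) P :=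
        i2.add (i3.const_mul 2)
      rw [← integral_const_mul, ← integral_add i2 (i3.const_mul 2), ← integral_add i4 j2]
      congr 1
      ext ω
      rw [partialSum_succ]; ring
    rw [this, e]
    have := h.sq_le n
    push_cast
    linarith

theorem integral_abs_partialSum_le (h : IsCentredSeq P Y s) (n : ℕ) :
    ∫ ω, |partialSum Y n ω| ∂P ≤ √(n * s) := by
  have := h.indep.isProbabilityMeasure
  obtain ⟨i1, i2, -⟩ := integrable_of_memLp_three (h.memLp_partialSum n)
  refine Real.le_sqrt_of_sq_le (le_trans ?_ (h.integral_sq_partialSum_le n))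
  have hL : MemLp (fun ω => |partialSum Y n ω|) 2 P :=
    ((h.memLp_partialSum n).mono_exponent (by norm_num)).abs
  have h1 := variance_nonneg (fun ω => |partialSum Y n ω|) P
  rw [variance_eq_sub hL] at h1
  have h2 : ∫ ω, ((fun ω => |partialSum Y n ω|) ^ 2) ω ∂P = ∫ ω, partialSum Y n ω ^ 2 ∂P := by
    simp
  linarith

/-- Adding one variable raises the third moment by at most `3 * √(n * s) * s + s`, which `1 ≤ s`
bounds by `4 * s ^ 2 * √(n + 1)`; summing these increments gives the order `n ^ (3 / 2)`. -/
theorem integral_abs_partialSum_pow_three_le (h : IsCentredSeq P Y s) (n : ℕ) :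
    ∫ ω, |partialSum Y n ω| ^ 3 ∂P ≤ 4 * s ^ 2 * (n * √n) := by
  have := h.indep.isProbabilityMeasure
  have hs := h.one_le
  induction n with
  | zero => simp [partialSum]
  | succ n ih =>
    obtain ⟨i1, i2, i3⟩ := integrable_of_memLp_three (h.memLp_partialSum n)
    obtain ⟨j1, j2, j3⟩ := integrable_of_memLp_three (h.memLp n)
    obtain ⟨-, -, k3⟩ := integrable_of_memLp_three (h.memLp_partialSum (n + 1))
    have hind := h.indepFun_partialSum n
    have q1 : Integrable (fun ω => partialSum Y n ω * |partialSum Y n ω|) P := by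
      refine i2.mono ((i1.1).mul (i1.1.norm)) (ae_of_all _ fun ω => ?_)
      simp [sq]
    have hi1 : IndepFun (fun ω => partialSum Y n ω * |partialSum Y n ω|) (Y n) P :=
      hind.comp (φ := fun x : ℝ => x * |x|) (ψ := id) (by fun_prop) measurable_id
    have hi2 : IndepFun (fun ω => |partialSum Y n ω|) (fun ω => Y n ω ^ 2) P :=
      hind.comp (φ := fun x : ℝ => |x|) (ψ := fun x => x ^ 2) (by fun_prop) (by fun_prop)
    have a1 : Integrable (fun ω => partialSum Y n ω * |partialSum Y n ω| * Y n ω) P :=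
      hi1.integrable_mul q1 j1
    have a2 : Integrable (fun ω => |partialSum Y n ω| * Y n ω ^ 2) P :=
      hi2.integrable_mul i1.abs j2
    have e1 : ∫ ω, partialSum Y n ω * |partialSum Y n ω| * Y n ω ∂P = 0 := by
      have := hi1.integral_mul_eq_mul_integral q1.1 j1.1
      simp only [h.mean n, mul_zero] at this
      exact this
    have e2 : ∫ ω, |partialSum Y n ω| * Y n ω ^ 2 ∂P ≤ √(n * s) * s := by
      have := hi2.integral_mul_eq_mul_integral i1.abs.1 j2.1
      have h3 : ∫ ω, |partialSum Y n ω| * Y n ω ^ 2 ∂P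
        = (∫ ω, |partialSum Y n ω| ∂P) * ∫ ω, Y n ω ^ 2 ∂P := this
      rw [h3]
      exact mul_le_mul (h.integral_abs_partialSum_le n) (h.sq_le n)
        (integral_nonneg fun _ => sq_nonneg _) (Real.sqrt_nonneg _)
    have hle : ∫ ω, |partialSum Y (n + 1) ω| ^ 3 ∂P
        ≤ ∫ ω, |partialSum Y n ω| ^ 3 ∂P
          + 3 * ∫ ω, partialSum Y n ω * |partialSum Y n ω| * Y n ω ∂P
          + 3 * ∫ ω, |partialSum Y n ω| * Y n ω ^ 2 ∂P + ∫ ω, |Y n ω| ^ 3 ∂P := by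
      have b1 : Integrable (fun ω => |partialSum Y n ω| ^ 3
          + 3 * (partialSum Y n ω * |partialSum Y n ω| * Y n ω)) P := i3.add (a1.const_mul 3)
      have b2 : Integrable (fun ω => |partialSum Y n ω| ^ 3
          + 3 * (partialSum Y n ω * |partialSum Y n ω| * Y n ω)
          + 3 * (|partialSum Y n ω| * Y n ω ^ 2)) P := b1.add (a2.const_mul 3)
      rw [← integral_const_mul, ← integral_const_mul, ← integral_add i3 (a1.const_mul 3),
        ← integral_add b1 (a2.const_mul 3), ← integral_add b2 j3]
      refine integral_mono k3 (b2.add j3) fun ω => ?_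
      simp only [partialSum_succ]
      exact abs_add_pow_three_le _ _
    have hc := h.cube_le n
    have hn : √(n : ℝ) ≤ √((n + 1 : ℕ) : ℝ) := Real.sqrt_le_sqrt (by push_cast; linarith)
    have h1 : 1 ≤ √((n + 1 : ℕ) : ℝ) := by
      rw [Real.one_le_sqrt]; push_cast; linarith [(n.cast_nonneg : (0 : ℝ) ≤ n)]
    have hss : √s ≤ s := Real.sqrt_le_iff.2 ⟨by linarith, by nlinarith⟩
    have hns : √(n * s) * s ≤ √((n + 1 : ℕ) : ℝ) * s ^ 2 := by
      rw [Real.sqrt_mul n.cast_nonneg, sq, mul_assoc]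
      gcongr
    have hss2 : s ≤ √((n + 1 : ℕ) : ℝ) * s ^ 2 := by nlinarith
    have hlast : (n : ℝ) * √n ≤ n * √((n + 1 : ℕ) : ℝ) := by gcongr
    have h4 : 4 * s ^ 2 * (n * √n) ≤ 4 * s ^ 2 * (n * √((n + 1 : ℕ) : ℝ)) := by gcongr
    have : 4 * s ^ 2 * (((n + 1 : ℕ) : ℝ) * √((n + 1 : ℕ) : ℝ))
      = 4 * s ^ 2 * (n * √((n + 1 : ℕ) : ℝ)) + 4 * (√((n + 1 : ℕ) : ℝ) * s ^ 2) := by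
      push_cast; ring
    rw [this]
    linarith

/-- A tail bound from Markov's inequality for the third absolute moment. -/
theorem measure_abs_partialSum_ge_le (h : IsCentredSeq P Y s) (n : ℕ) {c : ℝ} (hc : 0 < c) :
    P {ω | c ≤ |partialSum Y n ω|} ≤ ENNReal.ofReal (4 * s ^ 2 * (n * √n) / c ^ 3) := by
  have := h.indep.isProbabilityMeasure
  obtain ⟨-, -, i3⟩ := integrable_of_memLp_three (h.memLp_partialSum n)
  have hm := mul_meas_ge_le_integral_of_nonneg (ae_of_all P fun ω => by positivity) i3 (c ^ 3)
  have hset : {ω | c ≤ |partialSum Y n ω|} ⊆ {ω | c ^ 3 ≤ |partialSum Y n ω| ^ 3} := fun ω hω =>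
    pow_le_pow_left₀ hc.le hω 3
  refine (measure_mono hset).trans ?_
  rw [← ENNReal.ofReal_toReal (measure_ne_top P {ω | c ^ 3 ≤ |partialSum Y n ω| ^ 3})]
  refine ENNReal.ofReal_le_ofReal ?_
  rw [le_div_iff₀ (by positivity), mul_comm]
  exact hm.trans (h.integral_abs_partialSum_pow_three_le n)

theorem stronglyMeasurable (h : IsCentredSeq P Y s) (j : ℕ) : StronglyMeasurable (Y j) :=
  (h.measurable j).stronglyMeasurable

/-- Conditional Jensen for the martingale of partial sums. The index is shifted because the natural
filtration at time `n` already contains `Y n`. -/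
theorem submartingale_abs_pow_three (h : IsCentredSeq P Y s) :
    Submartingale (fun n ω => |partialSum Y (n + 1) ω| ^ 3) (Filtration.natural Y h.stronglyMeasurable) P := by
  have := h.indep.isProbabilityMeasure
  have hadp : ∀ n, StronglyMeasurable[Filtration.natural Y h.stronglyMeasurable n] (partialSum Y (n + 1)) := by
    intro n
    unfold partialSum
    refine Finset.stronglyMeasurable_fun_sum _ fun j hj => ?_
    exact (Filtration.stronglyAdapted_natural h.stronglyMeasurable j).mono
      ((Filtration.natural Y h.stronglyMeasurable).mono (Nat.lt_succ_iff.1 (Finset.mem_range.1 hj)))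
  refine submartingale_nat (fun n => ?_) (fun n => ?_) fun n => ?_
  · exact (continuous_pow 3).comp_stronglyMeasurable (hadp n).norm
  · exact (integrable_of_memLp_three (h.memLp_partialSum (n + 1))).2.2
  · obtain ⟨i1, -, -⟩ := integrable_of_memLp_three (h.memLp_partialSum (n + 1))
    obtain ⟨j1, -, -⟩ := integrable_of_memLp_three (h.memLp (n + 1))
    obtain ⟨k1, -, k3⟩ := integrable_of_memLp_three (h.memLp_partialSum (n + 1 + 1))
    have hle := (Filtration.natural Y h.stronglyMeasurable).le n
    have hconv : ConvexOn ℝ Set.univ (fun x : ℝ => |x| ^ 3) :=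
      (convexOn_norm convex_univ).pow (fun _ _ => norm_nonneg _) 3
    have hJ := hconv.map_condExp_le_univ hle (by fun_prop : Continuous fun x : ℝ => |x| ^ 3).lowerSemicontinuous k1 k3
    have hsum : partialSum Y (n + 1 + 1) = partialSum Y (n + 1) + Y (n + 1) := by
      ext ω; simp [partialSum_succ]
    have h1 : P[partialSum Y (n + 1 + 1) | Filtration.natural Y h.stronglyMeasurable n]
        =ᵐ[P] partialSum Y (n + 1) := by
      rw [hsum]
      refine (condExp_add i1 j1 _).trans ?_
      rw [condExp_of_stronglyMeasurable hle (hadp n) i1]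
      filter_upwards [h.indep.condExp_natural_ae_eq_of_lt h.stronglyMeasurable (Nat.lt_succ_self n)] with ω hω
      simp [hω, h.mean]
    filter_upwards [hJ, h1] with ω hω h1ω
    simp only [Function.comp_apply, h1ω] at hω
    exact hω

/-- Doob's maximal inequality for the third absolute moment of the partial sums. -/
theorem measure_exists_abs_partialSum_ge_le (h : IsCentredSeq P Y s) (n : ℕ) {c : ℝ} (hc : 0 < c) :
    P {ω | ∃ m ≤ n, c ≤ |partialSum Y m ω|} ≤ ENNReal.ofReal (4 * s ^ 2 * (n * √n) / c ^ 3) := by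
  have := h.indep.isProbabilityMeasure
  rcases n with _ | n
  · simp only [Nat.le_zero, exists_eq_left]
    have : {ω : Ω | c ≤ |partialSum Y 0 ω|} = ∅ := by
      ext ω; simp [partialSum, hc]
    simp [this]
  have hD := maximal_ineq h.submartingale_abs_pow_three
    (fun n ω => by simp only [Pi.zero_apply]; positivity) (ε := ⟨c ^ 3, by positivity⟩) n
  set A := {ω | ((⟨c ^ 3, by positivity⟩ : NNReal) : ℝ) ≤ (Finset.range (n + 1)).sup'
    Finset.nonempty_range_add_one fun k => |partialSum Y (k + 1) ω| ^ 3} with hA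
  have hsub : {ω | ∃ m ≤ n + 1, c ≤ |partialSum Y m ω|} ⊆ A := by
    rintro ω ⟨m, hm, hcm⟩
    rcases m with _ | m
    · simp [partialSum] at hcm; linarith
    · simp only [hA, Set.mem_ofPred_eq, Finset.le_sup'_iff, Finset.mem_range]
      exact ⟨m, by omega, pow_le_pow_left₀ hc.le hcm 3⟩
  refine (measure_mono hsub).trans ?_
  obtain ⟨-, -, i3⟩ := integrable_of_memLp_three (h.memLp_partialSum (n + 1))
  have h2 : ENNReal.ofReal (c ^ 3) * P A ≤ ENNReal.ofReal (4 * s ^ 2 * ((n + 1 : ℕ) * √(n + 1 : ℕ))) := by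
    rw [ENNReal.ofReal_eq_coe_nnreal (by positivity : (0 : ℝ) ≤ c ^ 3)]
    refine hD.trans (ENNReal.ofReal_le_ofReal ?_)
    exact (setIntegral_le_integral i3 (ae_of_all _ fun ω => by simp only [Pi.zero_apply]; positivity)).trans
      (h.integral_abs_partialSum_pow_three_le (n + 1))
  rw [ENNReal.ofReal_div_of_pos (by positivity), ENNReal.le_div_iff_mul_le (by simp [hc])
    (by simp), mul_comm]
  exact h2

end IsCentredSeq

end ThirdMoment

/-! ### Bounds on the exploration bonus -/

section Bonus

theorem one_le_zetaSum {x : ℝ} (hx : 1 < x) : 1 ≤ zetaSum x := by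
  have hs : Summable fun n : ℕ => 1 / ((n : ℝ) + 1) ^ x := by
    have := (summable_nat_add_iff 1).2 (Real.summable_one_div_nat_rpow.2 hx)
    simpa using this
  have := hs.le_tsum 0 fun n _ => by positivity
  simpa [zetaSum] using this

theorem a₂_pos {q M : ℝ} (hq : 0 < q) (hM : 0 < M) : 0 < a₂ q M := by
  unfold a₂; positivity

theorem a₁_pos {q M : ℝ} (hq : 0 < q) (hM : 0 < M) : 0 < a₁ q M := by
  unfold a₁; positivity

theorem log_two_mul_zetaSum_nonneg : 0 ≤ Real.log (2 * zetaSum (2 + 1)) :=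
  Real.log_nonneg (by linarith [one_le_zetaSum (x := 2 + 1) (by norm_num)])

/-- Keeps only the `3 * log n` of the logarithmic branch; this is all that positivity of the
limiting bound needs. -/
theorem sqrt_log_div_le_bonus {q M α : ℝ} (hq : 0 < q) (hM : 0 < M) (hα : α ∈ Set.Ioo (0 : ℝ) 1)
    (n : ℕ) : √(3 / a₂ q M * Real.log n / n) ≤ bonus q M α 2 n := by
  refine le_max_of_le_right (Real.sqrt_le_sqrt ?_)
  have h1 := log_two_mul_zetaSum_nonneg
  have h2 : 0 ≤ Real.log (1 / α) := Real.log_nonneg (by rw [le_div_iff₀ hα.1]; linarith [hα.2])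
  have h3 := a₂_pos hq hM
  have : 3 / a₂ q M * Real.log n / n = (3 * Real.log n) / (a₂ q M * n) := by
    rw [div_mul_eq_mul_div, div_div]
  rw [this]
  have h4 : (2 + 1 : ℝ) * Real.log n = 3 * Real.log n := by norm_num
  refine div_le_div_of_nonneg_right ?_ (by positivity)
  rw [h4]
  generalize Real.log (2 * zetaSum (2 + 1)) = u at h1 ⊢
  linarith

theorem exists_polynomial_part_le {q c : ℝ} (hq : 3 < q) (hc : 0 < c) :
    ∃ A : ℝ, 0 < A ∧ ∀ δ : ℝ, 0 < δ → ∀ n : ℕ, A * δ ^ (-(q / (q - 3))) ≤ n →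
      (c / (n : ℝ) ^ (q - 1 - 2)) ^ (1 / q) ≤ δ / 2 := by
  have hq3 : 0 < q - 3 := by linarith
  have hq0 : 0 < q := by linarith
  refine ⟨(c * 2 ^ q) ^ (1 / (q - 3)), by positivity, fun δ hδ n hn => ?_⟩
  have hn0 : (0 : ℝ) < n := lt_of_lt_of_le (by positivity) hn
  have h1 : c * 2 ^ q * δ ^ (-q) ≤ (n : ℝ) ^ (q - 3) := by
    have := Real.rpow_le_rpow (by positivity) hn hq3.le
    rw [Real.mul_rpow (by positivity) (by positivity), ← Real.rpow_mul (by positivity),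
      ← Real.rpow_mul hδ.le] at this
    have e1 : 1 / (q - 3) * (q - 3) = 1 := by field_simp
    have e2 : -(q / (q - 3)) * (q - 3) = -q := by field_simp
    rwa [e1, e2, Real.rpow_one] at this
  have e3 : q - 1 - 2 = q - 3 := by ring
  rw [e3, one_div, Real.rpow_inv_le_iff_of_pos (by positivity) (by positivity) hq0,
    div_le_iff₀ (by positivity), Real.div_rpow hδ.le (by norm_num)]
  calc c = δ ^ q / 2 ^ q * (c * 2 ^ q * δ ^ (-q)) := by
        rw [Real.rpow_neg hδ.le]; field_simp
    _ ≤ _ := by gcongr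

theorem exists_affine_log_div_le (c : ℝ) {ε : ℝ} (hε : 0 < ε) :
    ∃ C : ℝ, 1 ≤ C ∧ ∀ x, C ≤ x → (c + 3 * Real.log x) / x ≤ ε := by
  have h1 : Tendsto (fun x : ℝ => (c + 3 * Real.log x) / x) atTop (nhds 0) := by
    have h2 : Tendsto (fun x : ℝ => Real.log x / x) atTop (nhds 0) := by
      simpa using Real.isLittleO_log_id_atTop.tendsto_div_nhds_zero
    have h3 : Tendsto (fun x : ℝ => c / x) atTop (nhds 0) :=
      tendsto_const_nhds.div_atTop tendsto_id
    have := h3.add (h2.const_mul 3)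
    simp only [mul_zero, add_zero] at this
    refine this.congr fun x => ?_
    ring
  obtain ⟨C, hC⟩ := eventually_atTop.1 (h1.eventually (ge_mem_nhds hε))
  exact ⟨max C 1, le_max_right _ _, fun x hx => hC x ((le_max_left _ _).trans hx)⟩

/-- With `L = 1 - log δ` and `n = x * δ ^ (-2) * L` one has `log n ≤ log x + 3 * L`. Since `1 ≤ L`,
a factor `L` cancels and the claim reduces to `(c + 9 + 3 * log x) / x ≤ a / 4`, free of `δ`. -/
theorem exists_log_part_le {c a : ℝ} (hc : 0 ≤ c) (ha : 0 < a) :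
    ∃ C : ℝ, 1 ≤ C ∧ ∀ δ : ℝ, 0 < δ → δ ≤ 1 → ∀ n : ℕ, C * ((δ ^ 2)⁻¹ * (1 - Real.log δ)) ≤ n →
      √((c + 3 * Real.log n) / (a * n)) ≤ δ / 2 := by
  obtain ⟨C, hC1, hC⟩ := exists_affine_log_div_le (c + 9) (ε := a / 4) (by positivity)
  refine ⟨C, hC1, fun δ hδ hδ1 n hn => ?_⟩
  have hlog : Real.log δ ≤ 0 := Real.log_nonpos hδ.le hδ1
  set L := 1 - Real.log δ with hL
  have hL1 : 1 ≤ L := by linarith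
  have hL0 : 0 < L := by linarith
  have hn0 : (0 : ℝ) < n := lt_of_lt_of_le (by positivity) hn
  set x : ℝ := n * δ ^ 2 / L with hx
  have hxn : (n : ℝ) = x * ((δ ^ 2)⁻¹ * L) := by rw [hx]; field_simp
  have hCx : C ≤ x := by
    rw [hxn] at hn
    exact le_of_mul_le_mul_right hn (by positivity)
  have hx1 : 1 ≤ x := hC1.trans hCx
  have hx0 : 0 < x := by linarith
  have hlx : 0 ≤ Real.log x := Real.log_nonneg hx1
  have hlogn : Real.log n ≤ Real.log x + 3 * L := by
    rw [hxn, Real.log_mul (by positivity) (by positivity), Real.log_mul (by positivity) (by positivity),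
      Real.log_inv, Real.log_pow]
    have := Real.log_le_sub_one_of_pos hL0
    push_cast
    linarith
  have hCx2 := hC x hCx
  rw [div_le_iff₀ hx0] at hCx2
  refine Real.sqrt_le_iff.2 ⟨by positivity, ?_⟩
  rw [div_le_iff₀ (by positivity)]
  calc c + 3 * Real.log n ≤ L * (c + 9 + 3 * Real.log x) := by nlinarith
    _ ≤ L * (a / 4 * x) := by gcongr
    _ = (δ / 2) ^ 2 * (a * n) := by rw [hxn]; field_simp; ring

/-- The bonus is at most `δ / 2` from a sample size of order
`δ ^ (-q / (q - 3)) + δ ^ (-2) * (1 + log (1 / δ))` on. -/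
theorem exists_bonus_le {q M α : ℝ} (hq : 3 < q) (hM : 0 < M) (hα : α ∈ Set.Ioo (0 : ℝ) 1) :
    ∃ A C : ℝ, 0 < A ∧ 1 ≤ C ∧ ∀ δ : ℝ, 0 < δ → δ ≤ 1 → ∀ n : ℕ,
      A * δ ^ (-(q / (q - 3))) + C * ((δ ^ 2)⁻¹ * (1 - Real.log δ)) ≤ n →
      bonus q M α 2 n ≤ δ / 2 := by
  have hα0 := hα.1
  have hq0 : 0 < q := by linarith
  have hz : 0 < zetaSum 2 := lt_of_lt_of_le one_pos (one_le_zetaSum (by norm_num))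
  have ha1 := a₁_pos hq0 hM
  obtain ⟨A, hA, hA'⟩ := exists_polynomial_part_le (c := 2 * a₁ q M * zetaSum 2 / α) hq (by positivity)
  have h2 : 0 ≤ Real.log (1 / α) := Real.log_nonneg (by rw [le_div_iff₀ hα.1]; linarith [hα.2])
  obtain ⟨C, hC, hC'⟩ := exists_log_part_le
    (c := Real.log (2 * zetaSum (2 + 1)) + Real.log (1 / α)) (a := a₂ q M)
    (add_nonneg log_two_mul_zetaSum_nonneg h2) (a₂_pos hq0 hM)
  refine ⟨A, C, hA, hC, fun δ hδ hδ1 n hn => ?_⟩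
  have hlog : Real.log δ ≤ 0 := Real.log_nonpos hδ.le hδ1
  have p1 : 0 ≤ A * δ ^ (-(q / (q - 3))) := by positivity
  have p2 : 0 ≤ C * ((δ ^ 2)⁻¹ * (1 - Real.log δ)) :=
    mul_nonneg (by linarith) (mul_nonneg (by positivity) (by linarith))
  refine max_le ?_ ?_
  · rw [← div_div]
    exact hA' δ hδ n (by linarith)
  · have h4 : Real.log (2 * zetaSum (2 + 1)) + (2 + 1) * Real.log n + Real.log (1 / α)
        = Real.log (2 * zetaSum (2 + 1)) + Real.log (1 / α) + 3 * Real.log n := by ring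
    rw [h4]
    exact hC' δ hδ hδ1 n (by linarith)

end Bonus

/-! ### The UCB process stays above the mean with positive probability -/

section Positivity

theorem div_cube_eq {x y : ℝ} (hx : 0 ≤ x) (hy : 0 < y) :
    x * √x / √y ^ 3 = (x / y) * √(x / y) := by
  rw [Real.sqrt_div hx]
  have h : √y ^ 3 = y * √y := by
    rw [pow_succ, Real.sq_sqrt hy.le]
  rw [h]
  have := Real.sqrt_pos.2 hy
  field_simp

/-- The average of two lower bounds for the logarithm. The shift by `r` is what turns the dyadic sum
below into a tail of a convergent series. -/
theorem log_add_ge {m N j r : ℕ} (hj : 2 ^ j ≤ m) (hr : 2 ^ r ≤ N) :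
    Real.log 2 / 2 * (j + r) ≤ Real.log ((m + N : ℕ) : ℝ) := by
  have h1 : (j : ℝ) * Real.log 2 ≤ Real.log ((m + N : ℕ) : ℝ) := by
    rw [← Real.log_pow]
    exact Real.log_le_log (by positivity) (by exact_mod_cast hj.trans (Nat.le_add_right _ _))
  have h2 : (r : ℝ) * Real.log 2 ≤ Real.log ((m + N : ℕ) : ℝ) := by
    rw [← Real.log_pow]
    exact Real.log_le_log (by positivity) (by exact_mod_cast hr.trans (Nat.le_add_left _ _))
  linarith

/-- A form of the law of the iterated logarithm: with high probability the partial sums never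
cross a boundary of order `√(n log n)` that is shifted far enough. -/
theorem exists_measure_crossing_le {c s : ℝ} (hc : 0 < c) :
    ∃ N : ℕ, 1 ≤ N ∧ ∀ {Ω : Type*} [MeasurableSpace Ω] (P : Measure Ω) (Y : ℕ → Ω → ℝ),
      IsCentredSeq P Y s →
      P {ω | ∃ m ≥ 1, √(c * ((m + N : ℕ) * Real.log (m + N : ℕ))) ≤ |partialSum Y m ω|} ≤ 1 / 2 := by
  set D : ℝ := c * (Real.log 2 / 2) with hD
  have hl2 : 0 < Real.log 2 := Real.log_pos one_lt_two
  have hD0 : 0 < D := by positivity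
  -- `u (j + r)` is the value of Doob's bound on the dyadic block `2 ^ j ≤ m < 2 ^ (j + 1)`, and `r`
  -- is chosen to make the sum over `j` at most `1 / 2`.
  set u : ℕ → ℝ := fun n => 4 * s ^ 2 * (2 / D * √(2 / D)) * (1 / (n : ℝ) ^ (3 / 2 : ℝ)) with hu
  have hu0 : ∀ n, 0 ≤ u n := fun n => by positivity
  have hus : Summable u := (Real.summable_one_div_nat_rpow.2 (by norm_num)).mul_left _
  have htend := ENNReal.tendsto_sum_nat_add (fun n => ENNReal.ofReal (u n))
    (by rw [← ENNReal.ofReal_tsum_of_nonneg hu0 hus]; exact ENNReal.ofReal_ne_top)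
  obtain ⟨r, hr, hr1⟩ := ((htend.eventually (ge_mem_nhds (show (0 : ENNReal) < 1 / 2 by simp))).and
    (eventually_ge_atTop 1)).exists
  refine ⟨2 ^ r, Nat.one_le_two_pow, fun {Ω} _ P Y h => le_trans ?_ hr⟩
  -- On block `j` the squared boundary is at least `b j`.
  set b : ℕ → ℝ := fun j => D * (2 ^ j * (j + r)) with hb
  have hb0 : ∀ j, 0 < b j := fun j => by
    have : (1 : ℝ) ≤ r := by exact_mod_cast hr1
    positivity
  have hsub : {ω | ∃ m ≥ 1, √(c * ((m + 2 ^ r : ℕ) * Real.log (m + 2 ^ r : ℕ))) ≤ |partialSum Y m ω|}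
      ⊆ ⋃ j : ℕ, {ω | ∃ m ≤ 2 ^ (j + 1), √(b j) ≤ |partialSum Y m ω|} := by
    rintro ω ⟨m, hm, hω⟩
    have h1 : 2 ^ Nat.log 2 m ≤ m := Nat.pow_log_le_self 2 (by omega)
    refine Set.mem_iUnion.2 ⟨Nat.log 2 m, m, (Nat.lt_pow_succ_log_self one_lt_two m).le,
      le_trans (Real.sqrt_le_sqrt ?_) hω⟩
    simp only [hb, hD, mul_assoc]
    refine mul_le_mul_of_nonneg_left ?_ hc.le
    have h2 := log_add_ge h1 (le_refl (2 ^ r))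
    have h3 : (2 : ℝ) ^ Nat.log 2 m ≤ ((m + 2 ^ r : ℕ) : ℝ) := by
      exact_mod_cast h1.trans (Nat.le_add_right _ _)
    calc Real.log 2 / 2 * (2 ^ Nat.log 2 m * ((Nat.log 2 m : ℝ) + r))
        = 2 ^ Nat.log 2 m * (Real.log 2 / 2 * ((Nat.log 2 m : ℝ) + r)) := by ring
      _ ≤ _ := mul_le_mul h3 h2 (by positivity) (by positivity)
  refine (measure_mono hsub).trans ((measure_iUnion_le _).trans (ENNReal.tsum_le_tsum fun j => ?_))
  refine (h.measure_exists_abs_partialSum_ge_le _ (Real.sqrt_pos.2 (hb0 j))).trans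
    (ENNReal.ofReal_le_ofReal (le_of_eq ?_))
  have hx0 : (0 : ℝ) ≤ ((2 ^ (j + 1) : ℕ) : ℝ) := Nat.cast_nonneg _
  have hjr : (0 : ℝ) < ((j + r : ℕ) : ℝ) := by exact_mod_cast (by omega : 0 < j + r)
  rw [mul_div_assoc, div_cube_eq hx0 (hb0 j)]
  have e : ((2 ^ (j + 1) : ℕ) : ℝ) / b j = 2 / D / ((j + r : ℕ) : ℝ) := by
    simp only [hb]
    push_cast at hjr ⊢
    field_simp
    ring
  have e2 : ((j + r : ℕ) : ℝ) ^ (3 / 2 : ℝ) = ((j + r : ℕ) : ℝ) * √((j + r : ℕ) : ℝ) := by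
    rw [Real.sqrt_eq_rpow]
    nth_rewrite 2 [← Real.rpow_one ((j + r : ℕ) : ℝ)]
    rw [← Real.rpow_add hjr]
    norm_num
  rw [e, Real.sqrt_div (by positivity)]
  simp only [hu]
  rw [e2]
  have := Real.sqrt_pos.2 hjr
  field_simp

variable {Ω : Type*} [MeasurableSpace Ω]

/-- A sequence of i.i.d. observations with mean `μ` whose centred version has moments bounded
by `s`. -/
structure IsObservationSeq (P : Measure Ω) (X : ℕ → Ω → ℝ) (μ s : ℝ) : Prop where
  measurable : ∀ j, Measurable (X j)
  indep : iIndepFun X P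
  memLp : ∀ j, MemLp (X j) 3 P
  mean : ∀ j, ∫ ω, X j ω ∂P = μ
  sq_le : ∀ j, ∫ ω, (X j ω - μ) ^ 2 ∂P ≤ s
  cube_le : ∀ j, ∫ ω, |X j ω - μ| ^ 3 ∂P ≤ s
  one_le : 1 ≤ s

namespace IsObservationSeq

variable {P : Measure Ω} {X : ℕ → Ω → ℝ} {μ s : ℝ}

theorem isCentredSeq (h : IsObservationSeq P X μ s) (N : ℕ) :
    IsCentredSeq P (fun j ω => X (N + j) ω - μ) s := by
  have := h.indep.isProbabilityMeasure
  refine ⟨fun j => (h.measurable _).sub_const _, ?_, fun j => (h.memLp _).sub (memLp_const _), ?_,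
    fun j => h.sq_le _, fun j => h.cube_le _, h.one_le⟩
  · exact (h.indep.precomp (add_right_injective N)).comp (fun _ x => x - μ) fun _ => by fun_prop
  · intro j
    rw [integral_sub ((h.memLp _).integrable (by norm_num)) (integrable_const _), h.mean]
    simp

theorem sampleMean_sub (X : ℕ → ℝ) (μ : ℝ) {n : ℕ} (hn : 1 ≤ n) :
    n * (sampleMean X n - μ) = ∑ j ∈ Finset.range n, (X j - μ) := by
  have : (n : ℝ) ≠ 0 := by positivity
  simp only [sampleMean, Finset.sum_sub_distrib, Finset.sum_const, Finset.card_range, nsmul_eq_mul]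
  field_simp

/-- The first `N` observations contribute nonnegatively to the centred sum, and the later ones lose
less than `√(c * n * log n) ≤ n * f n`. -/
theorem le_ucb_of_partialSum {f : ℕ → ℝ} {c : ℝ} (hc : 0 < c)
    (hf : ∀ n : ℕ, √(c * Real.log n / n) ≤ f n) {N : ℕ} {x : ℕ → ℝ} (h1 : ∀ j < N, μ ≤ x j)
    (h2 : ∀ m ≥ 1, |∑ j ∈ Finset.range m, (x (N + j) - μ)|
      < √(c * ((m + N : ℕ) * Real.log (m + N : ℕ)))) {n : ℕ} (hn : 1 ≤ n) : μ ≤ ucb f x n := by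
  have hn0 : (0 : ℝ) < n := by exact_mod_cast hn
  have hf0 : 0 ≤ f n := (Real.sqrt_nonneg _).trans (hf n)
  have key : 0 ≤ ∑ j ∈ Finset.range n, (x j - μ) + n * f n := by
    rcases le_or_gt n N with hnN | hnN
    · refine add_nonneg (Finset.sum_nonneg fun j hj => ?_) (by positivity)
      have := h1 j (lt_of_lt_of_le (Finset.mem_range.1 hj) hnN)
      linarith
    · obtain ⟨m, rfl⟩ := Nat.exists_eq_add_of_le hnN.le
      have hm : m ≥ 1 := by omega
      rw [Finset.sum_range_add]
      have h3 : 0 ≤ ∑ j ∈ Finset.range N, (x j - μ) := Finset.sum_nonneg fun j hj => by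
        have := h1 j (Finset.mem_range.1 hj)
        linarith
      have h4 := (abs_lt.1 (h2 m hm)).1
      have h5 : √(c * ((m + N : ℕ) * Real.log (m + N : ℕ))) ≤ (N + m : ℕ) * f (N + m) := by
        rw [add_comm m N]
        refine le_trans (le_of_eq ?_) (mul_le_mul_of_nonneg_left (hf (N + m)) hn0.le)
        nth_rewrite 3 [← Real.sqrt_sq hn0.le]
        rw [← Real.sqrt_mul (by positivity)]
        congr 1
        field_simp
      linarith
  rw [← sampleMean_sub x μ hn, ← mul_add] at key
  have := nonneg_of_mul_nonneg_right key hn0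
  simp only [ucb]
  linarith

theorem measurableSet_crossing {Ω : Type*} {_ : MeasurableSpace Ω} {Z : ℕ → Ω → ℝ}
    (hZ : ∀ j, Measurable (Z j)) (g : ℕ → ℝ) :
    MeasurableSet {ω | ∃ m ≥ 1, g m ≤ |partialSum Z m ω|} := by
  have : {ω | ∃ m ≥ 1, g m ≤ |partialSum Z m ω|}
      = ⋃ m ∈ {m : ℕ | m ≥ 1}, {ω | g m ≤ |partialSum Z m ω|} := by
    ext ω; simp
  rw [this]
  refine MeasurableSet.biUnion (Set.to_countable _) fun m _ => ?_
  unfold partialSum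
  exact measurableSet_le measurable_const (Finset.measurable_fun_sum _ fun j _ => hZ j).abs

/-- The event contains the intersection of two independent ones: the first `N` observations are at
least `μ`, each with positive probability since `μ` is the mean, and the later sums do not cross the
boundary, with probability at least `1 / 2`. -/
theorem measure_le_ucb_pos (h : IsObservationSeq P X μ s) {f : ℕ → ℝ} {c : ℝ} (hc : 0 < c)
    (hf : ∀ n : ℕ, √(c * Real.log n / n) ≤ f n) :
    0 < P {ω | ∀ n ≥ 1, μ ≤ ucb f (fun j => X j ω) n} := by
  have := h.indep.isProbabilityMeasure
  obtain ⟨N, hN, hcross⟩ := exists_measure_crossing_le (s := s) hc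
  have hC := h.isCentredSeq N
  have hcross := hcross P _ hC
  set B := {ω | ∃ m ≥ 1, √(c * ((m + N : ℕ) * Real.log (m + N : ℕ)))
    ≤ |partialSum (fun j ω => X (N + j) ω - μ) m ω|} with hB
  set A := ⋂ j ∈ Finset.range N, {ω | μ ≤ X j ω} with hA
  have hsub : A ∩ Bᶜ ⊆ {ω | ∀ n ≥ 1, μ ≤ ucb f (fun j => X j ω) n} := by
    rintro ω ⟨hωA, hωB⟩ n hn
    simp only [hA, Set.mem_iInter, Finset.mem_range] at hωA
    refine le_ucb_of_partialSum hc hf (N := N) (fun j hj => hωA j hj) (fun m hm => ?_) hn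
    by_contra! hcon
    exact hωB ⟨m, hm, hcon⟩
  refine lt_of_lt_of_le ?_ (measure_mono hsub)
  have hmeas : ∀ j, MeasurableSpace.comap (X j) inferInstance ≤ ‹MeasurableSpace Ω› :=
    fun j => (h.measurable j).comap_le
  have hind := indep_iSup_of_disjoint hmeas h.indep.iIndep (S := Set.Iio N) (T := Set.Ici N)
    (Set.disjoint_left.2 fun j hj hj' => absurd (Set.mem_Iio.1 hj) (not_lt.2 hj'))
  have hmA : MeasurableSet[⨆ j ∈ Set.Iio N, MeasurableSpace.comap (X j) inferInstance] A := by
    refine Finset.measurableSet_biInter _ fun j hj => ?_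
    have hle : MeasurableSpace.comap (X j) inferInstance
        ≤ ⨆ j ∈ Set.Iio N, MeasurableSpace.comap (X j) inferInstance :=
      le_iSup₂_of_le j (Finset.mem_range.1 hj) le_rfl
    exact hle _ ⟨Set.Ici μ, measurableSet_Ici, rfl⟩
  have hmB : MeasurableSet[⨆ j ∈ Set.Ici N, MeasurableSpace.comap (X j) inferInstance] Bᶜ := by
    have hXm : ∀ j, Measurable[⨆ j ∈ Set.Ici N, MeasurableSpace.comap (X j) inferInstance]
        (X (N + j)) := fun j =>
      (comap_measurable (X (N + j))).mono (le_iSup₂_of_le (N + j) (by simp) le_rfl) le_rfl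
    exact (measurableSet_crossing (fun j => (hXm j).sub_const μ) _).compl
  rw [(Indep_iff _ _ P).1 hind A Bᶜ hmA hmB]
  refine ENNReal.mul_pos ?_ ?_
  · have hA' : A = ⋂ j ∈ Finset.range N, X j ⁻¹' Set.Ici μ := rfl
    rw [hA', h.indep.meas_biInter fun j _ => ⟨Set.Ici μ, measurableSet_Ici, rfl⟩]
    refine Finset.prod_ne_zero_iff.2 fun j _ => ne_of_gt ?_
    have := measure_integral_le_pos ((h.memLp j).integrable (by norm_num))
    rwa [h.mean j] at this
  · have hBm : MeasurableSet B := by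
      have := (iSup₂_le fun j _ => hmeas j :
        (⨆ j ∈ Set.Ici N, MeasurableSpace.comap (X j) inferInstance) ≤ ‹MeasurableSpace Ω›) _ hmB
      exact this.of_compl
    rw [measure_compl hBm (measure_ne_top _ _), measure_univ]
    refine ne_of_gt (tsub_pos_of_lt (lt_of_le_of_lt hcross ?_))
    simp

end IsObservationSeq

end Positivity

/-! ### Pathwise analysis of the algorithm -/

section Pathwise

/-- One plus the number of sample sizes `1 ≤ n < L` at which the UCB value is at least `v`. -/
def overcount (v : ℝ) (L : ℕ) (u : ℕ → ℝ) : ℕ :=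
  1 + ((Finset.Ico 1 L).filter fun n => v ≤ u n).card

variable {ι : Type*} [Fintype ι] [DecidableEq ι]

/-- An alternative is only sampled again if its UCB value is at least a lower bound for the UCB
values of another alternative. -/
theorem le_of_lt_counts (rule : ArgmaxRule ι) {U : ι → ℕ → ℝ} (B : ℝ) {b : ι} {v : ℝ}
    (hb : ∀ n ≥ 1, v ≤ U b n) (t : ℕ) (i : ι) :
    1 ≤ counts rule U B t i ∧ ∀ n, 1 ≤ n → n < counts rule U B t i → v ≤ U i n := by
  induction t generalizing i with
  | zero => exact ⟨le_rfl, fun n h1 h2 => absurd h2 (not_lt.2 h1)⟩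
  | succ t ih =>
    by_cases h : ((∑ i, counts rule U B t i : ℕ) : ℝ) < B
    · simp only [counts, if_pos h]
      set p := rule.pick fun i => U i (counts rule U B t i) with hp
      by_cases hi : i = p
      · subst hi
        simp only [Function.update_self]
        refine ⟨by omega, fun n h1 h2 => ?_⟩
        rcases Nat.lt_succ_iff_lt_or_eq.1 h2 with h3 | h3
        · exact (ih _).2 n h1 h3
        · subst h3
          exact (hb _ (ih b).1).trans (rule.le_pick (fun i => U i (counts rule U B t i)) b)
      · simp only [Function.update_of_ne hi]
        exact ih i
    · simp only [counts, if_neg h]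
      exact ih i

/-- The value below `v` at size `L` stops sampling there at the latest, so every size that was
passed is among those counted. -/
theorem counts_le_overcount (rule : ArgmaxRule ι) {U : ι → ℕ → ℝ} (B : ℝ) {b : ι} {v : ℝ}
    (hb : ∀ n ≥ 1, v ≤ U b n) (t : ℕ) {i : ι} {L : ℕ} (hL : 1 ≤ L) (hi : U i L < v) :
    counts rule U B t i ≤ overcount v L (U i) := by
  obtain ⟨h1, h2⟩ := le_of_lt_counts rule B hb t i
  have hle : counts rule U B t i ≤ L := by
    by_contra! hcon
    exact absurd (h2 L hL hcon) (not_le.2 hi)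
  have hsub : Finset.Ico 1 (counts rule U B t i) ⊆ (Finset.Ico 1 L).filter fun n => v ≤ U i n := by
    intro n hn
    rw [Finset.mem_Ico] at hn
    exact Finset.mem_filter.2 ⟨Finset.mem_Ico.2 ⟨hn.1, hn.2.trans_le hle⟩, h2 n hn.1 hn.2⟩
  have := Finset.card_le_card hsub
  rw [Nat.card_Ico] at this
  unfold overcount
  omega

/-- The others share less than `B / 2`, so `b` exceeds `B / 2` and no other alternative can match
its size, whatever the tie-breaking. -/
theorem output_eq_of_overcount (rule out : ArgmaxRule ι) {U : ι → ℕ → ℝ} {B : ℝ} {b : ι} {v : ℝ}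
    (hb : ∀ n ≥ 1, v ≤ U b n) {L : ℕ} (hL : 1 ≤ L) (hi : ∀ i ≠ b, U i L < v)
    (hB : 2 * ∑ i ∈ Finset.univ.erase b, (overcount v L (U i) : ℝ) < B) :
    output rule out U B = b := by
  by_contra hne
  have hle : ∀ i ≠ b, (finalCounts rule U B i : ℝ) ≤ overcount v L (U i) := fun i hib => by
    exact_mod_cast counts_le_overcount rule B hb _ hL (hi i hib)
  have hpick := out.le_pick (fun i => (finalCounts rule U B i : ℝ)) b
  have hne' := hle _ hne
  have h1 : ∑ i ∈ Finset.univ.erase b, (finalCounts rule U B i : ℝ)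
      ≤ ∑ i ∈ Finset.univ.erase b, (overcount v L (U i) : ℝ) :=
    Finset.sum_le_sum fun i hi => hle i (Finset.ne_of_mem_erase hi)
  have h2 : (overcount v L (U (output rule out U B)) : ℝ)
      ≤ ∑ i ∈ Finset.univ.erase b, (overcount v L (U i) : ℝ) :=
    Finset.single_le_sum (f := fun i => (overcount v L (U i) : ℝ)) (fun i _ => Nat.cast_nonneg _)
      (Finset.mem_erase.2 ⟨hne, Finset.mem_univ _⟩)
  have h3 := le_sum_finalCounts rule U B
  push_cast at h3
  rw [← Finset.add_sum_erase _ _ (Finset.mem_univ b)] at h3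
  unfold output at hne' h2
  linarith

end Pathwise

/-! ### Power sums -/

section PowerSums

theorem sum_rpow_neg_le {p : ℝ} (hp0 : 0 ≤ p) (hp1 : p < 1) (K : ℕ) :
    ∑ i ∈ Finset.range K, ((i : ℝ) + 1) ^ (-p) ≤ (K : ℝ) ^ (1 - p) / (1 - p) := by
  have h1p : 0 < 1 - p := by linarith
  induction K with
  | zero => simp [Real.zero_rpow h1p.ne']
  | succ K ih =>
    rw [Finset.sum_range_succ]
    have hK : (0 : ℝ) < (K : ℝ) + 1 := by positivity
    -- Bernoulli's inequality for the exponent `1 - p` in `[0, 1]` bounds the increment of `K ^ (1 -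
    -- p)` from below.
    have hb := rpow_one_add_le_one_add_mul_self (s := -(1 / ((K : ℝ) + 1)))
      (by rw [neg_le_neg_iff, div_le_one hK]; linarith [(K.cast_nonneg : (0 : ℝ) ≤ K)])
      h1p.le (by linarith : 1 - p ≤ 1)
    have e1 : (K : ℝ) = ((K : ℝ) + 1) * (1 + -(1 / ((K : ℝ) + 1))) := by field_simp; ring
    have e2 : (0 : ℝ) ≤ 1 + -(1 / ((K : ℝ) + 1)) := by
      have : 1 / ((K : ℝ) + 1) ≤ 1 := by
        rw [div_le_one hK]; linarith [(K.cast_nonneg : (0 : ℝ) ≤ K)]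
      linarith
    have h2 : (K : ℝ) ^ (1 - p) ≤ ((K : ℝ) + 1) ^ (1 - p) - (1 - p) * ((K : ℝ) + 1) ^ (-p) := by
      have e3 : ((K : ℝ) + 1) ^ (1 - p) = ((K : ℝ) + 1) * ((K : ℝ) + 1) ^ (-p) := by
        rw [sub_eq_add_neg, Real.rpow_add hK, Real.rpow_one]
      calc (K : ℝ) ^ (1 - p)
          = ((K : ℝ) + 1) ^ (1 - p) * (1 + -(1 / ((K : ℝ) + 1))) ^ (1 - p) := by
            nth_rewrite 1 [e1]
            rw [Real.mul_rpow hK.le e2]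
        _ ≤ ((K : ℝ) + 1) ^ (1 - p) * (1 + (1 - p) * -(1 / ((K : ℝ) + 1))) := by gcongr
        _ = _ := by rw [e3]; field_simp; ring
    push_cast
    rw [le_div_iff₀ h1p] at ih ⊢
    linarith

/-- The relative positions `i / k` for `i = 1, …, k`. -/
theorem sum_relative_rpow_neg_le {p : ℝ} (hp0 : 0 ≤ p) (hp1 : p < 1) (k : ℕ) :
    ∑ i : Fin (k + 1), (((i : ℝ) + 1) / ((k : ℝ) + 1)) ^ (-p) ≤ ((k : ℝ) + 1) / (1 - p) := by
  have hK : (0 : ℝ) < (k : ℝ) + 1 := by positivity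
  have h := sum_rpow_neg_le hp0 hp1 (k + 1)
  rw [← Fin.sum_univ_eq_sum_range (fun i : ℕ => ((i : ℝ) + 1) ^ (-p))] at h
  have e : ∀ i : Fin (k + 1), (((i : ℝ) + 1) / ((k : ℝ) + 1)) ^ (-p)
      = ((k : ℝ) + 1) ^ p * ((i : ℝ) + 1) ^ (-p) := fun i => by
    rw [Real.div_rpow (by positivity) hK.le, Real.rpow_neg hK.le p]
    field_simp
  simp only [e, ← Finset.mul_sum]
  calc ((k : ℝ) + 1) ^ p * ∑ i : Fin (k + 1), ((i : ℝ) + 1) ^ (-p)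
      ≤ ((k : ℝ) + 1) ^ p * (((k : ℝ) + 1) ^ (1 - p) / (1 - p)) := by
        gcongr
        exact_mod_cast h
    _ = ((k : ℝ) + 1) / (1 - p) := by
        rw [← mul_div_assoc, ← Real.rpow_add hK]
        simp

/-- Telescoping: with `x = √n` and `y = √(n + 1)`, `y - x = 1 / (x + y) ≥ 1 / (3 * x)` and `y ≤ 2 *
x`, whence the factor `6`. -/
theorem sum_Ico_inv_mul_sqrt_le {a : ℕ} (ha : 1 ≤ a) (L : ℕ) :
    ∑ n ∈ Finset.Ico a L, 1 / ((n : ℝ) * √n) ≤ 6 / √a := by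
  rcases le_or_gt L a with hL | hL
  · rw [Finset.Ico_eq_empty_of_le hL]
    simp only [Finset.sum_empty]
    positivity
  have hstep : ∀ n ∈ Finset.Ico a L, 1 / ((n : ℝ) * √n) ≤ 6 / √(n : ℝ) - 6 / √((n + 1 : ℕ) : ℝ) := by
    intro n hn
    have hn1 : (1 : ℝ) ≤ n := by exact_mod_cast ha.trans (Finset.mem_Ico.1 hn).1
    have hx : 0 < √(n : ℝ) := Real.sqrt_pos.2 (by linarith)
    have hx2 : √(n : ℝ) ^ 2 = n := Real.sq_sqrt (by linarith)
    have hy : 0 < √((n + 1 : ℕ) : ℝ) := Real.sqrt_pos.2 (by push_cast; linarith)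
    have hy2 : √((n + 1 : ℕ) : ℝ) ^ 2 = n + 1 := by rw [Real.sq_sqrt (by positivity)]; push_cast; ring
    set x := √(n : ℝ)
    set y := √((n + 1 : ℕ) : ℝ)
    have hxy : x < y := by nlinarith
    have hy2x : y ≤ 2 * x := by nlinarith
    rw [← hx2, div_sub_div _ _ hx.ne' hy.ne', div_le_div_iff₀ (by positivity) (by positivity)]
    have h1 : (y - x) * (y + x) = 1 := by nlinarith
    have h3 : 1 ≤ 3 * x * (y - x) := by nlinarith
    have h4 : y * 1 ≤ (2 * x) * (3 * x * (y - x)) := mul_le_mul hy2x h3 zero_le_one (by positivity)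
    nlinarith
  refine (Finset.sum_le_sum hstep).trans ?_
  rw [Finset.sum_Ico_eq_sum_range]
  have := Finset.sum_range_sub' (fun m => 6 / √((a + m : ℕ) : ℝ)) (L - a)
  simp only [← add_assoc] at this
  rw [this]
  simp only [add_zero]
  linarith [show (0 : ℝ) ≤ 6 / √((a + (L - a) : ℕ) : ℝ) by positivity]

end PowerSums

/-! ### Concentration of the total sample size of the inferior alternatives -/

section Overcount

theorem measurable_ucb (f : ℕ → ℝ) {Ω : Type*} {_ : MeasurableSpace Ω} {X : ℕ → Ω → ℝ}
    (hX : ∀ j, Measurable (X j)) (n : ℕ) : Measurable fun ω => ucb f (fun j => X j ω) n := by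
  unfold ucb sampleMean
  exact ((Finset.measurable_fun_sum _ fun j _ => hX j).div_const _).add_const _

theorem overcount_eq_sum_indicator (v : ℝ) (L : ℕ) (f : ℕ → ℝ) {Ω : Type*} (X : ℕ → Ω → ℝ) (ω : Ω) :
    (overcount v L (ucb f fun j => X j ω) : ℝ) = 1 + ∑ n ∈ Finset.Ico 1 L,
      {ω | v ≤ ucb f (fun j => X j ω) n}.indicator (fun _ => (1 : ℝ)) ω := by
  rw [overcount, Finset.card_filter]
  push_cast
  simp only [Set.indicator_apply, Set.mem_ofPred_eq]

theorem measurable_overcount (v : ℝ) (L : ℕ) (f : ℕ → ℝ) {Ω : Type*} {_ : MeasurableSpace Ω}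
    {X : ℕ → Ω → ℝ} (hX : ∀ j, Measurable (X j)) :
    Measurable fun ω => (overcount v L (ucb f fun j => X j ω) : ℝ) := by
  simp only [overcount_eq_sum_indicator]
  exact (Finset.measurable_fun_sum _ fun n _ => measurable_const.indicator
    (measurableSet_le measurable_const (measurable_ucb f hX n))).const_add _

theorem overcount_le {v : ℝ} {L : ℕ} (hL : 1 ≤ L) (u : ℕ → ℝ) : overcount v L u ≤ L := by
  have := Finset.card_filter_le (Finset.Ico 1 L) fun n => v ≤ u n
  rw [Nat.card_Ico] at this
  unfold overcount
  omega

variable {Ω : Type*} [MeasurableSpace Ω] {P : Measure Ω}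

namespace IsObservationSeq

variable {X : ℕ → Ω → ℝ} {μ s δ : ℝ} {f : ℕ → ℝ}

/-- The bonus covers at most half the gap, so the centred sum must reach `n * δ / 2`; the
third-moment Markov bound then applies. -/
theorem measureReal_le_ucb_le (h : IsObservationSeq P X μ s) (hδ : 0 < δ) {n : ℕ} (hn : 1 ≤ n)
    (hf : f n ≤ δ / 2) :
    P.real {ω | μ + δ ≤ ucb f (fun j => X j ω) n} ≤ 32 * s ^ 2 / δ ^ 3 * (1 / (n * √n)) := by
  have := h.indep.isProbabilityMeasure
  have hn0 : (0 : ℝ) < n := by exact_mod_cast hn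
  have hC := h.isCentredSeq 0
  have hsub : {ω | μ + δ ≤ ucb f (fun j => X j ω) n}
      ⊆ {ω | n * (δ / 2) ≤ |partialSum (fun j ω => X (0 + j) ω - μ) n ω|} := by
    intro ω hω
    simp only [Set.mem_ofPred_eq, ucb] at hω
    simp only [Set.mem_ofPred_eq, partialSum, zero_add]
    rw [← sampleMean_sub (fun j => X j ω) μ hn]
    refine le_trans ?_ (le_abs_self _)
    gcongr
    linarith
  have hm := (measure_mono hsub).trans (hC.measure_abs_partialSum_ge_le n (c := n * (δ / 2)) (by positivity))
  have := ENNReal.toReal_mono ENNReal.ofReal_ne_top hm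
  rw [ENNReal.toReal_ofReal (by positivity)] at this
  refine this.trans (le_of_eq ?_)
  have hx2 : √(n : ℝ) ^ 2 = n := Real.sq_sqrt hn0.le
  have hx : 0 < √(n : ℝ) := Real.sqrt_pos.2 hn0
  set x := √(n : ℝ)
  rw [← hx2]
  field_simp
  ring

/-- Sizes below `n₀` are all counted; the `2` is the initial observation plus rounding. The later
probabilities sum to at most `32 * s ^ 2 * δ ^ (-3) * 6 / √n₀`, and `n₀ ≥ δ ^ (-2)` brings this down
to order `δ ^ (-2)`. -/
theorem integral_overcount_le (h : IsObservationSeq P X μ s) (hδ : 0 < δ) {n₀ : ℝ}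
    (hn₀ : (δ ^ 2)⁻¹ ≤ n₀) (hf : ∀ n : ℕ, n₀ ≤ n → f n ≤ δ / 2) (L : ℕ) :
    ∫ ω, (overcount (μ + δ) L (ucb f fun j => X j ω) : ℝ) ∂P
      ≤ 2 + n₀ + 192 * s ^ 2 * (δ ^ 2)⁻¹ := by
  have := h.indep.isProbabilityMeasure
  have hms : ∀ n, MeasurableSet {ω | μ + δ ≤ ucb f (fun j => X j ω) n} := fun n =>
    measurableSet_le measurable_const (measurable_ucb f h.measurable n)
  have hint : ∀ n, Integrable ({ω | μ + δ ≤ ucb f (fun j => X j ω) n}.indicator fun _ => (1 : ℝ)) P :=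
    fun n => (integrable_const 1).indicator (hms n)
  simp only [overcount_eq_sum_indicator]
  rw [integral_add (integrable_const _) (integrable_finsetSum _ fun n _ => hint n),
    integral_finsetSum _ fun n _ => hint n]
  have e : ∀ n, ∫ ω, {ω | μ + δ ≤ ucb f (fun j => X j ω) n}.indicator (fun _ => (1 : ℝ)) ω ∂P
      = P.real {ω | μ + δ ≤ ucb f (fun j => X j ω) n} := fun n => by
    rw [integral_indicator_const _ (hms n)]; simp
  simp only [e, integral_const, probReal_univ, smul_eq_mul, one_mul]
  have hn₀0 : 0 < n₀ := lt_of_lt_of_le (by positivity) hn₀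
  set a := ⌈n₀⌉₊ with ha
  have ha1 : 1 ≤ a := Nat.one_le_iff_ne_zero.2 (Nat.ceil_pos.2 hn₀0).ne'
  have han : n₀ ≤ a := Nat.le_ceil _
  have han' : (a : ℝ) < n₀ + 1 := Nat.ceil_lt_add_one hn₀0.le
  have hsplit : ∑ n ∈ Finset.Ico 1 L, P.real {ω | μ + δ ≤ ucb f (fun j => X j ω) n}
      ≤ ∑ n ∈ Finset.Ico 1 a, P.real {ω | μ + δ ≤ ucb f (fun j => X j ω) n}
        + ∑ n ∈ Finset.Ico a L, P.real {ω | μ + δ ≤ ucb f (fun j => X j ω) n} := by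
    rw [← Finset.sum_union (Finset.disjoint_left.2 fun x hx hx' => by
      rw [Finset.mem_Ico] at hx hx'; omega)]
    refine Finset.sum_le_sum_of_subset_of_nonneg (fun x hx => ?_) fun _ _ _ => measureReal_nonneg
    rw [Finset.mem_union, Finset.mem_Ico, Finset.mem_Ico]
    rw [Finset.mem_Ico] at hx
    omega
  have h1 : ∑ n ∈ Finset.Ico 1 a, P.real {ω | μ + δ ≤ ucb f (fun j => X j ω) n} ≤ a := by
    refine (Finset.sum_le_card_nsmul _ _ 1 fun n _ => measureReal_le_one).trans ?_
    simp only [Nat.card_Ico, nsmul_eq_mul, mul_one]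
    exact_mod_cast Nat.sub_le _ _
  have h2 : ∑ n ∈ Finset.Ico a L, P.real {ω | μ + δ ≤ ucb f (fun j => X j ω) n}
      ≤ 192 * s ^ 2 * (δ ^ 2)⁻¹ := by
    have hle : ∀ n ∈ Finset.Ico a L, P.real {ω | μ + δ ≤ ucb f (fun j => X j ω) n}
        ≤ 32 * s ^ 2 / δ ^ 3 * (1 / (n * √n)) := fun n hn => by
      have hn' := (Finset.mem_Ico.1 hn).1
      exact h.measureReal_le_ucb_le hδ (ha1.trans hn') (hf n (han.trans (by exact_mod_cast hn')))
    refine (Finset.sum_le_sum hle).trans ?_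
    rw [← Finset.mul_sum]
    have hs := sum_Ico_inv_mul_sqrt_le ha1 L
    have hsq : δ⁻¹ ≤ √(a : ℝ) := by
      refine Real.le_sqrt_of_sq_le ?_
      rw [inv_pow]
      exact hn₀.trans han
    have h6 : 6 / √(a : ℝ) ≤ 6 * δ := by
      calc 6 / √(a : ℝ) ≤ 6 / δ⁻¹ := by gcongr
        _ = 6 * δ := by field_simp
    calc 32 * s ^ 2 / δ ^ 3 * ∑ n ∈ Finset.Ico a L, 1 / ((n : ℝ) * √n)
        ≤ 32 * s ^ 2 / δ ^ 3 * (6 * δ) := by gcongr; exact hs.trans h6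
      _ = 192 * s ^ 2 * (δ ^ 2)⁻¹ := by field_simp; ring
  linarith

end IsObservationSeq

variable {ι : Type*}

theorem indepFun_overcount {X : ι → ℕ → Ω → ℝ} (hX : ∀ i j, Measurable (X i j))
    (hind : iIndepFun (fun p : ι × ℕ => X p.1 p.2) P) (v : ℝ) (L : ℕ) (f : ℕ → ℝ) {i j : ι}
    (hij : i ≠ j) :
    IndepFun (fun ω => (overcount v L (ucb f fun n => X i n ω) : ℝ))
      (fun ω => (overcount v L (ucb f fun n => X j n ω) : ℝ)) P := by
  have hmeas : ∀ p : ι × ℕ, MeasurableSpace.comap (X p.1 p.2) inferInstance ≤ ‹MeasurableSpace Ω› :=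
    fun p => (hX p.1 p.2).comap_le
  have h := indep_iSup_of_disjoint hmeas hind.iIndep (S := {p | p.1 = i}) (T := {p | p.1 = j})
    (Set.disjoint_left.2 fun p hp hp' => hij (hp.symm.trans hp'))
  have hle : ∀ i : ι, MeasurableSpace.comap
      (fun ω => (overcount v L (ucb f fun n => X i n ω) : ℝ)) inferInstance
      ≤ ⨆ p ∈ {p : ι × ℕ | p.1 = i}, MeasurableSpace.comap (X p.1 p.2) inferInstance := by
    intro i
    refine Measurable.comap_le (measurable_overcount v L f fun n => ?_)
    exact (comap_measurable (X i n)).mono (le_iSup₂_of_le (i, n) rfl le_rfl) le_rfl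
  exact (IndepFun_iff_Indep _ _ _).2 (indep_of_indep_of_le_left
    (indep_of_indep_of_le_right h (hle j)) (hle i))

/-- A variable with values in `[0, L]` has variance at most `L` times its mean, so Chebyshev gives
`L * T / T ^ 2`. -/
theorem measure_sum_overcount_ge_le [IsProbabilityMeasure P] {X : ι → ℕ → Ω → ℝ}
    (hX : ∀ i j, Measurable (X i j)) (hind : iIndepFun (fun p : ι × ℕ => X p.1 p.2) P)
    (v : ℝ) {L : ℕ} (hL : 1 ≤ L) (f : ℕ → ℝ) (I : Finset ι) {T : ℝ} (hT : 0 < T)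
    (hle : ∑ i ∈ I, ∫ ω, (overcount v L (ucb f fun n => X i n ω) : ℝ) ∂P ≤ T) :
    P {ω | 2 * T ≤ ∑ i ∈ I, (overcount v L (ucb f fun n => X i n ω) : ℝ)}
      ≤ ENNReal.ofReal (L / T) := by
  set W : ι → Ω → ℝ := fun i ω => (overcount v L (ucb f fun n => X i n ω) : ℝ) with hW
  have hW0 : ∀ i ω, 0 ≤ W i ω := fun i ω => Nat.cast_nonneg _
  have hWL : ∀ i ω, W i ω ≤ L := fun i ω => Nat.cast_le.2 (overcount_le hL _)
  have hWm : ∀ i, Measurable (W i) := fun i => measurable_overcount v L f (hX i)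
  have hWp : ∀ i, MemLp (W i) 2 P := fun i =>
    MemLp.of_bound (hWm i).aestronglyMeasurable L (ae_of_all _ fun ω => by
      rw [Real.norm_of_nonneg (hW0 i ω)]; exact hWL i ω)
  have hWi : ∀ i, Integrable (W i) P := fun i => (hWp i).integrable one_le_two
  have hvar : Var[∑ i ∈ I, W i; P] ≤ L * T := by
    rw [IndepFun.variance_sum (fun i _ => hWp i)
      fun i _ j _ hij => indepFun_overcount hX hind v L f hij]
    calc ∑ i ∈ I, Var[W i; P] ≤ ∑ i ∈ I, L * ∫ ω, W i ω ∂P := by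
          refine Finset.sum_le_sum fun i _ => (variance_le_expectation_sq (hWm i).aestronglyMeasurable).trans ?_
          rw [← integral_const_mul]
          refine integral_mono (hWp i).integrable_sq ((hWi i).const_mul _) fun ω => ?_
          simp only [Pi.pow_apply, sq]
          exact mul_le_mul_of_nonneg_right (hWL i ω) (hW0 i ω)
      _ ≤ L * T := by rw [← Finset.mul_sum]; gcongr
  have hmean : P[∑ i ∈ I, W i] ≤ T := by
    have : P[∑ i ∈ I, W i] = ∑ i ∈ I, ∫ ω, W i ω ∂P := by
      rw [← integral_finsetSum _ fun i _ => hWi i]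
      simp
    rw [this]; exact hle
  have hch := meas_ge_le_variance_div_sq (memLp_finsetSum' I fun i _ => hWp i) hT
  refine (measure_mono fun ω hω => ?_).trans (hch.trans (ENNReal.ofReal_le_ofReal ?_))
  · simp only [Set.mem_ofPred_eq] at hω ⊢
    refine le_trans ?_ (le_abs_self _)
    rw [Finset.sum_apply]
    linarith
  · rw [div_le_div_iff₀ (by positivity) hT]
    nlinarith

/-- A lower bound for the probability that the algorithm outputs the alternative `b`. -/
theorem measure_le_measure_output_add [Fintype ι] [DecidableEq ι] {X : ι → ℕ → Ω → ℝ} {μ δ n₀ : ι → ℝ} {s v T : ℝ} {b : ι}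
    (hobs : ∀ i, IsObservationSeq P (X i) (μ i) s)
    (hind : iIndepFun (fun p : ι × ℕ => X p.1 p.2) P) {f : ℕ → ℝ}
    (hδ : ∀ i ≠ b, 0 < δ i) (hv : ∀ i ≠ b, μ i + δ i = v) (hn₀ : ∀ i ≠ b, (δ i ^ 2)⁻¹ ≤ n₀ i)
    (hf : ∀ i ≠ b, ∀ n : ℕ, n₀ i ≤ n → f n ≤ δ i / 2) {L : ℕ} (hL : 1 ≤ L)
    (hLn : ∀ i ≠ b, n₀ i ≤ L) (hT : 0 < T)
    (hsum : ∑ i ∈ Finset.univ.erase b, (2 + n₀ i + 192 * s ^ 2 * (δ i ^ 2)⁻¹) ≤ T)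
    (rule out : ArgmaxRule ι) :
    P {ω | ∀ n ≥ 1, v ≤ ucb f (fun j => X b j ω) n}
      ≤ P {ω | output rule out (fun i n => ucb f (fun j => X i j ω) n) (4 * T) = b}
        + (ENNReal.ofReal (∑ i ∈ Finset.univ.erase b, 32 * s ^ 2 / δ i ^ 3 * (1 / (L * √L)))
          + ENNReal.ofReal (L / T)) := by
  have := hind.isProbabilityMeasure
  set I := Finset.univ.erase b with hI
  have hIb : ∀ i ∈ I, i ≠ b := fun i hi => Finset.ne_of_mem_erase hi
  -- The two bad events: `G`, some inferior alternative is not yet ruled out at size `L`; `H`, the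
  -- truncated overcounts use up half of the budget `4 * T`.
  set G := ⋃ i ∈ I, {ω | v ≤ ucb f (fun j => X i j ω) L} with hG
  set H := {ω | 2 * T ≤ ∑ i ∈ I, (overcount v L (ucb f fun n => X i n ω) : ℝ)} with hH
  have hPG : P G ≤ ENNReal.ofReal (∑ i ∈ I, 32 * s ^ 2 / δ i ^ 3 * (1 / (L * √L))) := by
    rw [ENNReal.ofReal_sum_of_nonneg fun i hi => by
      have := hδ i (hIb i hi)
      positivity]
    refine (measure_biUnion_finset_le _ _).trans (Finset.sum_le_sum fun i hi => ?_)
    have hib := hIb i hi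
    rw [← ofReal_measureReal]
    refine ENNReal.ofReal_le_ofReal ?_
    rw [← hv i hib]
    exact (hobs i).measureReal_le_ucb_le (hδ i hib) hL (hf i hib L (hLn i hib))
  have hPH : P H ≤ ENNReal.ofReal (L / T) := by
    refine measure_sum_overcount_ge_le (fun i => (hobs i).measurable) hind v hL f I hT
      ((Finset.sum_le_sum fun i hi => ?_).trans hsum)
    have hib := hIb i hi
    rw [← hv i hib]
    exact (hobs i).integral_overcount_le (hδ i hib) (hn₀ i hib) (hf i hib) L
  have hsub : {ω | ∀ n ≥ 1, v ≤ ucb f (fun j => X b j ω) n}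
      ⊆ {ω | output rule out (fun i n => ucb f (fun j => X i j ω) n) (4 * T) = b} ∪ (G ∪ H) := by
    intro ω hω
    by_cases hωG : ω ∈ G
    · exact Or.inr (Or.inl hωG)
    by_cases hωH : ω ∈ H
    · exact Or.inr (Or.inr hωH)
    refine Or.inl (output_eq_of_overcount rule out hω hL (fun i hib => ?_) ?_)
    · by_contra! hcon
      exact hωG (Set.mem_biUnion (Finset.mem_coe.2 (Finset.mem_erase.2 ⟨hib, Finset.mem_univ i⟩)) hcon)
    · have : ¬ (2 * T ≤ ∑ i ∈ I, (overcount v L (ucb f fun n => X i n ω) : ℝ)) := hωH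
      linarith
  calc _ ≤ _ := measure_mono hsub
    _ ≤ _ := measure_union_le _ _
    _ ≤ _ := by gcongr; exact (measure_union_le _ _).trans (add_le_add hPG hPH)

end Overcount

/-! ### Moments in the sampling model -/

section SamplingModel

/-- A bound for the second and third absolute central moments of a variable whose `q`-th absolute
moment is at most `M`. -/
def centralMomentBound (M : ℝ) : ℝ := 1 + 4 * ((1 + M) + (1 + M) ^ 3)

theorem one_le_centralMomentBound {M : ℝ} (hM : 0 < M) : 1 ≤ centralMomentBound M := by
  have : 0 ≤ 4 * ((1 + M) + (1 + M) ^ 3) := by positivity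
  unfold centralMomentBound
  linarith

theorem abs_pow_le_one_add_rpow {q : ℝ} {n : ℕ} (hq : n ≤ q) (x : ℝ) : |x| ^ n ≤ 1 + |x| ^ q := by
  rcases le_or_gt |x| 1 with h | h
  · have := pow_le_one₀ (n := n) (abs_nonneg x) h
    have h2 : 0 ≤ |x| ^ q := by positivity
    linarith
  · have := Real.rpow_le_rpow_of_exponent_le h.le hq
    rw [Real.rpow_natCast] at this
    linarith

variable {Ω : Type*} [MeasurableSpace Ω] {P : Measure Ω}

theorem integral_abs_pow_le [IsProbabilityMeasure P] {Z : Ω → ℝ} (hZ : AEStronglyMeasurable Z P)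
    {q M : ℝ} (hi : Integrable (fun ω => |Z ω| ^ q) P) (hM : ∫ ω, |Z ω| ^ q ∂P ≤ M) {n : ℕ}
    (hn : n ≤ q) : ∫ ω, |Z ω| ^ n ∂P ≤ 1 + M := by
  have h1 : Integrable (fun ω => 1 + |Z ω| ^ q) P := (integrable_const _).add hi
  have h2 : Integrable (fun ω => |Z ω| ^ n) P := by
    refine h1.mono (hZ.norm.pow n) (ae_of_all _ fun ω => ?_)
    rw [Real.norm_of_nonneg (by positivity), Real.norm_of_nonneg (by positivity)]
    exact abs_pow_le_one_add_rpow hn _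
  calc ∫ ω, |Z ω| ^ n ∂P ≤ ∫ ω, (1 + |Z ω| ^ q) ∂P :=
        integral_mono h2 h1 fun ω => abs_pow_le_one_add_rpow hn _
    _ = 1 + ∫ ω, |Z ω| ^ q ∂P := by
        rw [integral_add (integrable_const _) hi]; simp
    _ ≤ 1 + M := by linarith

theorem memLp_three_of_integrable_rpow [IsProbabilityMeasure P] {Z : Ω → ℝ}
    (hZ : AEStronglyMeasurable Z P) {q : ℝ} (hq : 3 < q)
    (hi : Integrable (fun ω => |Z ω| ^ q) P) : MemLp Z 3 P := by
  have h : MemLp Z (ENNReal.ofReal q) P := by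
    rw [← integrable_norm_rpow_iff hZ (by simp; linarith) ENNReal.ofReal_ne_top,
      ENNReal.toReal_ofReal (by linarith)]
    exact hi
  refine h.mono_exponent ?_
  rw [← ENNReal.ofReal_ofNat 3]
  exact ENNReal.ofReal_le_ofReal hq.le

theorem integral_abs_sub_mean_pow_three_le [IsProbabilityMeasure P] {Z : Ω → ℝ}
    (hZ : AEStronglyMeasurable Z P) {q M : ℝ} (hq : 3 < q)
    (hi : Integrable (fun ω => |Z ω| ^ q) P) (hM : ∫ ω, |Z ω| ^ q ∂P ≤ M) :
    ∫ ω, |Z ω - ∫ ω', Z ω' ∂P| ^ 3 ∂P ≤ 4 * ((1 + M) + (1 + M) ^ 3) := by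
  have hL := memLp_three_of_integrable_rpow hZ hq hi
  set μ := ∫ ω', Z ω' ∂P with hμ
  have h3 := integral_abs_pow_le hZ hi hM (n := 3) (by exact_mod_cast hq.le)
  have h1 := integral_abs_pow_le hZ hi hM (n := 1) (by push_cast; linarith)
  have hμ1 : |μ| ≤ 1 + M := by
    refine (abs_integral_le_integral_abs).trans ?_
    simpa using h1
  have i3 := (IsCentredSeq.integrable_of_memLp_three hL).2.2
  have j3 := (IsCentredSeq.integrable_of_memLp_three (hL.sub (memLp_const μ))).2.2
  have hpt : ∀ ω, |Z ω - μ| ^ 3 ≤ 4 * (|Z ω| ^ 3 + |μ| ^ 3) := fun ω => by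
    have h4 := add_pow_le (abs_nonneg (Z ω)) (abs_nonneg μ) 3
    norm_num at h4
    exact (pow_le_pow_left₀ (abs_nonneg _) (abs_sub _ _) 3).trans h4
  calc ∫ ω, |Z ω - μ| ^ 3 ∂P ≤ ∫ ω, 4 * (|Z ω| ^ 3 + |μ| ^ 3) ∂P :=
        integral_mono j3 ((i3.add (integrable_const _)).const_mul 4) hpt
    _ = 4 * (∫ ω, |Z ω| ^ 3 ∂P + |μ| ^ 3) := by
        rw [integral_const_mul, integral_add i3 (integrable_const _)]; simp
    _ ≤ _ := by gcongr

theorem IsSamplingModel.isObservationSeq [IsProbabilityMeasure P] {ι : Type*} {X : ι → ℕ → Ω → ℝ}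
    (h : IsSamplingModel P X) {q M : ℝ} (hq : 3 < q) (hM : 0 < M) (hm : MomentCondition P X q M)
    (i : ι) : IsObservationSeq P (X i) (∫ ω, X i 0 ω ∂P) (centralMomentBound M) := by
  have hZ : AEStronglyMeasurable (X i 0) P := (h.measurable i 0).aestronglyMeasurable
  have hL := memLp_three_of_integrable_rpow hZ hq (hm.integrable i)
  have hc := integral_abs_sub_mean_pow_three_le hZ hq (hm.integrable i) (hm.moment_le i)
  set μ := ∫ ω, X i 0 ω ∂P with hμ
  have hLμ : MemLp (fun ω => X i 0 ω - μ) 3 P := hL.sub (memLp_const μ)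
  obtain ⟨-, j2, j3⟩ := IsCentredSeq.integrable_of_memLp_three hLμ
  have hcube : ∀ j, ∫ ω, |X i j ω - μ| ^ 3 ∂P = ∫ ω, |X i 0 ω - μ| ^ 3 ∂P := fun j =>
    ((h.identDistrib i j).comp (u := fun x : ℝ => |x - μ| ^ 3) (by fun_prop)).integral_eq
  have hsq : ∀ j, ∫ ω, (X i j ω - μ) ^ 2 ∂P = ∫ ω, (X i 0 ω - μ) ^ 2 ∂P := fun j =>
    ((h.identDistrib i j).comp (u := fun x : ℝ => (x - μ) ^ 2) (by fun_prop)).integral_eq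
  have hpos : 0 ≤ 4 * ((1 + M) + (1 + M) ^ 3) := by positivity
  refine ⟨h.measurable i, h.indep.precomp (g := fun j => (i, j)) (Prod.mk_right_injective i),
    fun j => (h.identDistrib i j).symm.memLp_snd hL, fun j => (h.identDistrib i j).integral_eq,
    fun j => ?_, fun j => ?_, one_le_centralMomentBound hM⟩
  · rw [hsq j]
    have : ∫ ω, (X i 0 ω - μ) ^ 2 ∂P ≤ ∫ ω, (1 + |X i 0 ω - μ| ^ 3) ∂P := by
      refine integral_mono j2 ((integrable_const _).add j3) fun ω => ?_
      have := abs_pow_le_one_add_rpow (q := 3) (n := 2) (by norm_num) (X i 0 ω - μ)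
      rw [sq_abs] at this
      refine this.trans (le_of_eq ?_)
      norm_cast
    rw [integral_add (integrable_const _) j3] at this
    simp only [integral_const, probReal_univ, smul_eq_mul, mul_one] at this
    unfold centralMomentBound
    linarith
  · rw [hcube j]
    unfold centralMomentBound
    linarith

theorem setOf_le_ucbInf {Ω : Type*} (f : ℕ → ℝ) (X : ℕ → Ω → ℝ) (μ : ℝ) :
    {ω | (μ : EReal) ≤ ucbInf f fun j => X j ω} = {ω | ∀ n ≥ 1, μ ≤ ucb f (fun j => X j ω) n} := by
  ext ω
  simp [ucbInf, le_iInf_iff]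

/-- The probability that the UCB process stays above a level is determined by the distribution of
a single observation. -/
theorem IsSamplingModel.measure_le_ucb_eq {ι : Type*} {X : ι → ℕ → Ω → ℝ} (h : IsSamplingModel P X)
    (i : ι) {ν : Measure ℝ} [IsProbabilityMeasure ν] (hν : P.map (X i 0) = ν) (f : ℕ → ℝ) (μ : ℝ) :
    P {ω | ∀ n ≥ 1, μ ≤ ucb f (fun j => X i j ω) n}
      = Measure.infinitePi (fun _ : ℕ => ν) {x | ∀ n ≥ 1, μ ≤ ucb f x n} := by
  have := h.indep.isProbabilityMeasure
  have hind : iIndepFun (X i) P :=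
    h.indep.precomp (g := fun j => (i, j)) (Prod.mk_right_injective i)
  have hlaw := hind.map_fun_eq_infinitePi_map (h.measurable i)
  have hmap : ∀ j, P.map (X i j) = ν := fun j => (h.identDistrib i j).map_eq.trans hν
  simp only [hmap] at hlaw
  have hms : MeasurableSet {x : ℕ → ℝ | ∀ n ≥ 1, μ ≤ ucb f x n} := by
    have e : {x : ℕ → ℝ | ∀ n ≥ 1, μ ≤ ucb f x n}
        = ⋂ n ∈ {n : ℕ | n ≥ 1}, {x : ℕ → ℝ | μ ≤ ucb f (fun j => x j) n} := by
      ext x; simp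
    rw [e]
    exact MeasurableSet.biInter (Set.to_countable _) fun n _ => measurableSet_le measurable_const
      (measurable_ucb f (X := fun j (x : ℕ → ℝ) => x j) (fun j => measurable_pi_apply j) n)
  rw [← hlaw, Measure.map_apply (measurable_pi_lambda _ (h.measurable i)) hms]
  rfl

end SamplingModel

/-! ### Asymptotics for many alternatives -/

section Asymptotics

/-- A sample size from which on the bonus is at most half of the optimality gap `δ`. -/
def sampleBound (A C r δ : ℝ) : ℝ := A * δ ^ (-r) + C * ((δ ^ 2)⁻¹ * (1 - Real.log δ))

theorem inv_sq_le_sampleBound {A C r δ : ℝ} (hA : 0 < A) (hC : 1 ≤ C) (hδ : 0 < δ) (hδ1 : δ ≤ 1) :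
    (δ ^ 2)⁻¹ ≤ sampleBound A C r δ := by
  have hlog : Real.log δ ≤ 0 := Real.log_nonpos hδ.le hδ1
  have h1 : 0 ≤ A * δ ^ (-r) := by positivity
  have h2 : 0 < (δ ^ 2)⁻¹ := by positivity
  have h3 : (δ ^ 2)⁻¹ ≤ (δ ^ 2)⁻¹ * (1 - Real.log δ) := le_mul_of_one_le_right h2.le (by linarith)
  have h4 : (δ ^ 2)⁻¹ * (1 - Real.log δ) ≤ C * ((δ ^ 2)⁻¹ * (1 - Real.log δ)) :=
    le_mul_of_one_le_left (h2.le.trans h3) hC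
  unfold sampleBound
  linarith

theorem sampleBound_rpow {A C r t β : ℝ} (ht : 0 < t) :
    sampleBound A C r (t ^ β)
      = A * t ^ (-(β * r)) + C * (t ^ (-(2 * β)) * (1 - β * Real.log t)) := by
  unfold sampleBound
  rw [← Real.rpow_mul ht.le, Real.log_rpow ht, ← Real.rpow_natCast, ← Real.rpow_mul ht.le,
    ← Real.rpow_neg ht.le]
  push_cast
  ring_nf

theorem neg_log_le_rpow_div {t h : ℝ} (ht : 0 < t) (hh : 0 < h) :
    -Real.log t ≤ t ^ (-h) / h := by
  have := Real.log_le_rpow_div (inv_pos.2 ht).le hh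
  rwa [Real.log_inv, Real.inv_rpow ht.le, ← Real.rpow_neg ht.le] at this

theorem sum_sampleBound_le {A C E r β : ℝ} (hA : 0 < A) (hC : 1 ≤ C) (hE : 0 ≤ E) (hr : 0 ≤ r)
    (hβ : 0 ≤ β) (hβr : β * r < 1) (hβ2 : β < 1 / 2) (k : ℕ) :
    ∑ i ∈ Finset.univ.erase (0 : Fin (k + 1)),
      (2 + sampleBound A C r ((((i : ℝ) + 1) / ((k : ℝ) + 1)) ^ β)
        + E * (((((i : ℝ) + 1) / ((k : ℝ) + 1)) ^ β) ^ 2)⁻¹)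
      ≤ (2 + A / (1 - β * r) + (C + E) / (1 - 2 * β) + 4 * C * β / (1 - 2 * β) ^ 2)
        * ((k : ℝ) + 1) := by
  have hC0 : 0 < C := by linarith
  -- The logarithm is absorbed into `t ^ (-h) / h`. This `h` keeps `2 * β + h < 1`, with `1 - (2 * β
  -- + h) = h`, so the power sum contributes a second `1 / h`: hence `4 / (1 - 2 * β) ^ 2`.
  set h := (1 - 2 * β) / 2 with hh
  have hh0 : 0 < h := by rw [hh]; linarith
  have hterm : ∀ i : Fin (k + 1), 2 + sampleBound A C r ((((i : ℝ) + 1) / ((k : ℝ) + 1)) ^ β)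
        + E * (((((i : ℝ) + 1) / ((k : ℝ) + 1)) ^ β) ^ 2)⁻¹
      ≤ 2 + A * (((i : ℝ) + 1) / ((k : ℝ) + 1)) ^ (-(β * r))
        + (C + E) * (((i : ℝ) + 1) / ((k : ℝ) + 1)) ^ (-(2 * β))
        + C * β / h * (((i : ℝ) + 1) / ((k : ℝ) + 1)) ^ (-(2 * β + h)) := by
    intro i
    have ht : 0 < ((i : ℝ) + 1) / ((k : ℝ) + 1) := by positivity
    set t := ((i : ℝ) + 1) / ((k : ℝ) + 1)
    rw [sampleBound_rpow ht, ← Real.rpow_natCast, ← Real.rpow_mul ht.le, ← Real.rpow_neg ht.le]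
    have e1 : β * ((2 : ℕ) : ℝ) = 2 * β := by push_cast; ring
    have e2 : t ^ (-(2 * β + h)) = t ^ (-(2 * β)) * t ^ (-h) := by
      rw [← Real.rpow_add ht]; congr 1; ring
    have hl := neg_log_le_rpow_div ht hh0
    have hl2 : C * β * t ^ (-(2 * β)) * -Real.log t ≤ C * β * t ^ (-(2 * β)) * (t ^ (-h) / h) := by
      gcongr
    have e3 : C * β / h * (t ^ (-(2 * β)) * t ^ (-h)) = C * β * t ^ (-(2 * β)) * (t ^ (-h) / h) := by
      ring
    rw [e1, e2, e3]
    linarith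
  have hnonneg : ∀ i : Fin (k + 1), 0 ≤ 2 + A * (((i : ℝ) + 1) / ((k : ℝ) + 1)) ^ (-(β * r))
        + (C + E) * (((i : ℝ) + 1) / ((k : ℝ) + 1)) ^ (-(2 * β))
        + C * β / h * (((i : ℝ) + 1) / ((k : ℝ) + 1)) ^ (-(2 * β + h)) := fun i => by positivity
  refine (Finset.sum_le_sum fun i _ => hterm i).trans
    ((Finset.sum_le_univ_sum_of_nonneg hnonneg).trans ?_)
  simp only [Finset.sum_add_distrib, ← Finset.mul_sum, Finset.sum_const, Finset.card_univ,
    Fintype.card_fin, nsmul_eq_mul]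
  have s1 := sum_relative_rpow_neg_le (p := β * r) (by positivity) hβr k
  have s2 := sum_relative_rpow_neg_le (p := 2 * β) (by positivity) (by linarith) k
  have s3 := sum_relative_rpow_neg_le (p := 2 * β + h) (by positivity) (by linarith) k
  have h1 : (0 : ℝ) < 1 - β * r := by linarith
  have h2 : (0 : ℝ) < 1 - 2 * β := by linarith
  have e4 : 1 - (2 * β + h) = h := by rw [hh]; ring
  rw [e4] at s3
  have t1 := mul_le_mul_of_nonneg_left s1 hA.le
  have t2 := mul_le_mul_of_nonneg_left s2 (by linarith : 0 ≤ C + E)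
  have t3 := mul_le_mul_of_nonneg_left s3 (by positivity : 0 ≤ C * β / h)
  have e5 : C * β / h * (((k : ℝ) + 1) / h) = 4 * C * β / (1 - 2 * β) ^ 2 * ((k : ℝ) + 1) := by
    rw [hh]; field_simp; ring
  have e6 : A * (((k : ℝ) + 1) / (1 - β * r)) = A / (1 - β * r) * ((k : ℝ) + 1) := by ring
  have e7 : (C + E) * (((k : ℝ) + 1) / (1 - 2 * β)) = (C + E) / (1 - 2 * β) * ((k : ℝ) + 1) := by ring
  rw [e5] at t3
  rw [e6] at t1
  rw [e7] at t2
  push_cast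
  linarith

/-- The smallest gap is the worst; with `x` the number of alternatives this bounds all thresholds at
once, so that a single `L` exceeds them. -/
theorem sampleBound_le_of_inv_le {A C r t β x : ℝ} (hA : 0 < A) (hC : 1 ≤ C) (hr : 0 ≤ r)
    (hβ : 0 ≤ β) (hβ1 : β ≤ 1) (hx : 0 < x) (ht : x⁻¹ ≤ t) (ht1 : t ≤ 1) :
    sampleBound A C r (t ^ β) ≤ A * x ^ (β * r) + C * (x ^ (2 * β) * (1 + Real.log x)) := by
  have ht0 : 0 < t := lt_of_lt_of_le (inv_pos.2 hx) ht
  rw [sampleBound_rpow ht0]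
  have hpow : ∀ p : ℝ, 0 ≤ p → t ^ (-p) ≤ x ^ p := fun p hp => by
    rw [Real.rpow_neg ht0.le, ← Real.inv_rpow ht0.le]
    exact Real.rpow_le_rpow (inv_pos.2 ht0).le (inv_le_of_inv_le₀ hx ht) hp
  have hlog : -Real.log t ≤ Real.log x := by
    rw [← Real.log_inv]
    exact Real.log_le_log (inv_pos.2 ht0) (inv_le_of_inv_le₀ hx ht)
  have hlog0 : 0 ≤ -Real.log t := by linarith [Real.log_nonpos ht0.le ht1]
  have h1 : -(β * Real.log t) ≤ Real.log x := by nlinarith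
  have h2 : 0 ≤ -(β * Real.log t) := by nlinarith
  have h3 := hpow (β * r) (by positivity)
  have h4 := hpow (2 * β) (by positivity)
  have h5 : t ^ (-(2 * β)) * (1 - β * Real.log t) ≤ x ^ (2 * β) * (1 + Real.log x) :=
    mul_le_mul h4 (by linarith) (by linarith) (by positivity)
  have h6 := mul_le_mul_of_nonneg_left h3 hA.le
  have h7 := mul_le_mul_of_nonneg_left h5 (by linarith : 0 ≤ C)
  linarith

theorem eventually_le_rpow {A C p b θ : ℝ} (hp : p < θ) (hb : b < θ) (hC : 0 ≤ C) :
    ∀ᶠ x : ℝ in atTop, A * x ^ p + C * (x ^ b * (1 + Real.log x)) ≤ x ^ θ := by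
  set h := (θ - b) / 2 with hh
  have hh0 : 0 < h := by rw [hh]; linarith
  have h1 : Tendsto (fun x : ℝ => A * x ^ (-(θ - p)) + C * (x ^ (-(θ - b)) + x ^ (-h) / h)) atTop
      (nhds (A * 0 + C * (0 + 0 / h))) :=
    ((tendsto_rpow_neg_atTop (by linarith)).const_mul A).add
      (((tendsto_rpow_neg_atTop (by linarith)).add
        ((tendsto_rpow_neg_atTop hh0).div_const h)).const_mul C)
  simp only [mul_zero, zero_div, add_zero] at h1
  filter_upwards [h1.eventually (ge_mem_nhds one_pos), eventually_gt_atTop 0] with x hx hx0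
  have e1 : x ^ p = x ^ (-(θ - p)) * x ^ θ := by rw [← Real.rpow_add hx0]; congr 1; ring
  have e2 : x ^ b = x ^ (-(θ - b)) * x ^ θ := by rw [← Real.rpow_add hx0]; congr 1; ring
  have e3 : x ^ (-(θ - b)) * x ^ h = x ^ (-h) := by
    rw [← Real.rpow_add hx0]; congr 1; rw [hh]; ring
  have hl := Real.log_le_rpow_div hx0.le hh0
  have h2 : x ^ (-(θ - b)) * Real.log x ≤ x ^ (-h) / h := by
    rw [← e3, mul_div_assoc]
    gcongr
  have hθ : 0 ≤ x ^ θ := by positivity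
  calc A * x ^ p + C * (x ^ b * (1 + Real.log x))
      = (A * x ^ (-(θ - p)) + C * (x ^ (-(θ - b)) + x ^ (-(θ - b)) * Real.log x)) * x ^ θ := by
        rw [e1, e2]; ring
    _ ≤ (A * x ^ (-(θ - p)) + C * (x ^ (-(θ - b)) + x ^ (-h) / h)) * x ^ θ := by gcongr
    _ ≤ 1 * x ^ θ := by gcongr
    _ = x ^ θ := one_mul _

/-- The exponent `3 * β` may exceed `1`, so one factor `t ^ (-β)` is bounded by its maximum `(k + 1)
^ β`, leaving the summable exponent `2 * β`. -/
theorem sum_inv_cube_le {β : ℝ} (hβ : 0 ≤ β) (hβ2 : β < 1 / 2) (k : ℕ) :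
    ∑ i ∈ Finset.univ.erase (0 : Fin (k + 1)), 1 / ((((i : ℝ) + 1) / ((k : ℝ) + 1)) ^ β) ^ 3
      ≤ ((k : ℝ) + 1) ^ (1 + β) / (1 - 2 * β) := by
  have hK : (0 : ℝ) < (k : ℝ) + 1 := by positivity
  refine (Finset.sum_le_univ_sum_of_nonneg fun i => by positivity).trans ?_
  have hterm : ∀ i : Fin (k + 1), 1 / ((((i : ℝ) + 1) / ((k : ℝ) + 1)) ^ β) ^ 3
      ≤ ((k : ℝ) + 1) ^ β * (((i : ℝ) + 1) / ((k : ℝ) + 1)) ^ (-(2 * β)) := by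
    intro i
    have ht : 0 < ((i : ℝ) + 1) / ((k : ℝ) + 1) := by positivity
    have ht' : (((i : ℝ) + 1) / ((k : ℝ) + 1))⁻¹ ≤ (k : ℝ) + 1 := by
      rw [inv_div, div_le_iff₀ (by positivity)]
      nlinarith [(Nat.cast_nonneg (i : ℕ) : (0 : ℝ) ≤ (i : ℕ))]
    set t := ((i : ℝ) + 1) / ((k : ℝ) + 1)
    have e : 1 / (t ^ β) ^ 3 = (t⁻¹) ^ β * t ^ (-(2 * β)) := by
      rw [Real.inv_rpow ht.le, ← Real.rpow_neg ht.le, ← Real.rpow_add ht, ← Real.rpow_natCast,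
        ← Real.rpow_mul ht.le, one_div, ← Real.rpow_neg ht.le]
      congr 1
      push_cast
      ring
    rw [e]
    gcongr
  refine (Finset.sum_le_sum fun i _ => hterm i).trans ?_
  rw [← Finset.mul_sum]
  have hs := sum_relative_rpow_neg_le (p := 2 * β) (by positivity) (by linarith) k
  calc ((k : ℝ) + 1) ^ β * ∑ i : Fin (k + 1), (((i : ℝ) + 1) / ((k : ℝ) + 1)) ^ (-(2 * β))
      ≤ ((k : ℝ) + 1) ^ β * (((k : ℝ) + 1) / (1 - 2 * β)) := by gcongr
    _ = ((k : ℝ) + 1) ^ (1 + β) / (1 - 2 * β) := by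
      rw [Real.rpow_add hK, Real.rpow_one]; ring

/-- The two error terms of the selection probability are negligible. -/
theorem sum_tail_le {β θ x S E : ℝ} (hx : 1 ≤ x) (hE : 0 ≤ E) (hθ : 0 ≤ θ)
    (hβ2 : β < 1 / 2) (hS : S ≤ x ^ (1 + β) / (1 - 2 * β)) {L : ℕ} (hL : L = ⌈x ^ θ⌉₊) {c : ℝ}
    (hc : 0 < c) :
    E * S * (1 / (L * √L)) + L / (c * x)
      ≤ E / (1 - 2 * β) * x ^ (-(3 / 2 * θ - (1 + β))) + 2 / c * x ^ (-(1 - θ)) := by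
  have hx0 : 0 < x := by linarith
  have h2 : (0 : ℝ) < 1 - 2 * β := by linarith
  have hxθ : 1 ≤ x ^ θ := Real.one_le_rpow hx hθ
  have hLge : x ^ θ ≤ L := by rw [hL]; exact Nat.le_ceil _
  have hLle : (L : ℝ) ≤ 2 * x ^ θ := by
    have := Nat.ceil_lt_add_one (zero_le_one.trans hxθ)
    rw [← hL] at this
    linarith
  have e1 : x ^ θ * √(x ^ θ) = x ^ (3 / 2 * θ) := by
    rw [Real.sqrt_eq_rpow, ← Real.rpow_mul hx0.le, ← Real.rpow_add hx0]
    congr 1; ring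
  have h3 : 1 / ((L : ℝ) * √L) ≤ 1 / x ^ (3 / 2 * θ) := by
    rw [← e1]
    gcongr
  have h4 : E * S * (1 / (L * √L)) ≤ E * (x ^ (1 + β) / (1 - 2 * β)) * (1 / x ^ (3 / 2 * θ)) := by
    refine mul_le_mul (mul_le_mul_of_nonneg_left hS hE) h3 (by positivity) ?_
    positivity
  have e2 : E * (x ^ (1 + β) / (1 - 2 * β)) * (1 / x ^ (3 / 2 * θ))
      = E / (1 - 2 * β) * x ^ (-(3 / 2 * θ - (1 + β))) := by
    rw [neg_sub, Real.rpow_sub hx0]; ring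
  have h5 : (L : ℝ) / (c * x) ≤ 2 * x ^ θ / (c * x) := by gcongr
  have e3 : 2 * x ^ θ / (c * x) = 2 / c * x ^ (-(1 - θ)) := by
    rw [neg_sub, Real.rpow_sub hx0, Real.rpow_one]; field_simp
  linarith

end Asymptotics

/-! ### The main estimate -/

section Main

/-- The probability of correct selection is, up to explicit errors, at least the probability that
the UCB process of the best alternative never falls below its mean. -/
theorem measure_le_PCS_add {Ω : Type*} [MeasurableSpace Ω] {P : Measure Ω} [IsProbabilityMeasure P]
    {q M A C β θ μ₁ : ℝ} {f : ℕ → ℝ} {k : ℕ} {X : Fin (k + 1) → ℕ → Ω → ℝ}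
    (hq : 3 < q) (hM : 0 < M) (hA : 0 < A) (hC : 1 ≤ C)
    (hf : ∀ δ : ℝ, 0 < δ → δ ≤ 1 → ∀ n : ℕ, sampleBound A C (q / (q - 3)) δ ≤ n → f n ≤ δ / 2)
    (hβ : 0 ≤ β) (hβq : β * (q / (q - 3)) < 1) (hβ2 : β < 1 / 2) (hθ : 0 ≤ θ)
    (hk : A * ((k : ℝ) + 1) ^ (β * (q / (q - 3)))
      + C * (((k : ℝ) + 1) ^ (2 * β) * (1 + Real.log ((k : ℝ) + 1))) ≤ ((k : ℝ) + 1) ^ θ)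
    (hX : IsSamplingModel P X) (hm : MomentCondition P X q M)
    (hmean : ∀ i : Fin (k + 1), i ≠ 0 →
      ∫ ω, X i 0 ω ∂P = μ₁ - (((i : ℝ) + 1) / ((k : ℝ) + 1)) ^ β)
    (rule out : ArgmaxRule (Fin (k + 1))) {c : ℝ}
    (hc : c = 2 + A / (1 - β * (q / (q - 3))) + (C + 192 * centralMomentBound M ^ 2) / (1 - 2 * β)
      + 4 * C * β / (1 - 2 * β) ^ 2) :
    P {ω | ∀ n ≥ 1, μ₁ ≤ ucb f (fun j => X 0 j ω) n}
      ≤ PCS P X f rule out (4 * (c * ((k : ℝ) + 1))) 0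
        + ENNReal.ofReal (32 * centralMomentBound M ^ 2 / (1 - 2 * β)
            * ((k : ℝ) + 1) ^ (-(3 / 2 * θ - (1 + β)))
          + 2 / c * ((k : ℝ) + 1) ^ (-(1 - θ))) := by
  have hr : 0 ≤ q / (q - 3) := div_nonneg (by linarith) (by linarith)
  have hK : (0 : ℝ) < (k : ℝ) + 1 := by positivity
  have hK1 : (1 : ℝ) ≤ (k : ℝ) + 1 := by linarith [(k.cast_nonneg : (0 : ℝ) ≤ k)]
  have h1 : (0 : ℝ) < 1 - β * (q / (q - 3)) := by linarith
  have h2 : (0 : ℝ) < 1 - 2 * β := by linarith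
  have hC0 : 0 < C := by linarith
  have hc0 : 0 < c := by rw [hc]; positivity
  set δ : Fin (k + 1) → ℝ := fun i => (((i : ℝ) + 1) / ((k : ℝ) + 1)) ^ β with hδ
  have hδ0 : ∀ i, 0 < δ i := fun i => by positivity
  have ht1 : ∀ i : Fin (k + 1), ((i : ℝ) + 1) / ((k : ℝ) + 1) ≤ 1 := fun i => by
    rw [div_le_one hK]
    exact_mod_cast i.2
  have hδ1 : ∀ i, δ i ≤ 1 := fun i => Real.rpow_le_one (by positivity) (ht1 i) hβ
  have hti : ∀ i : Fin (k + 1), ((k : ℝ) + 1)⁻¹ ≤ ((i : ℝ) + 1) / ((k : ℝ) + 1) := fun i => by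
    rw [inv_eq_one_div]
    gcongr
    linarith [(Nat.cast_nonneg (i : ℕ) : (0 : ℝ) ≤ (i : ℕ))]
  set L := ⌈((k : ℝ) + 1) ^ θ⌉₊ with hL
  have hL1 : 1 ≤ L := Nat.one_le_iff_ne_zero.2 (Nat.ceil_pos.2 (by positivity)).ne'
  have hmain := measure_le_measure_output_add (b := (0 : Fin (k + 1))) (v := μ₁)
    (T := c * ((k : ℝ) + 1)) (δ := δ) (n₀ := fun i => sampleBound A C (q / (q - 3)) (δ i))
    (fun i => hX.isObservationSeq hq hM hm i) hX.indep (f := f) (fun i _ => hδ0 i)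
    (fun i hi => by rw [hmean i hi]; simp only [hδ]; ring)
    (fun i _ => inv_sq_le_sampleBound hA hC (hδ0 i) (hδ1 i))
    (fun i _ n hn => hf (δ i) (hδ0 i) (hδ1 i) n hn) hL1
    (fun i _ => ((sampleBound_le_of_inv_le hA hC hr hβ (by linarith) hK (hti i) (ht1 i)).trans
      hk).trans (Nat.le_ceil _)) (by positivity)
    (by
      rw [hc]
      exact sum_sampleBound_le hA hC (by positivity) hr hβ hβq hβ2 k) rule out
  refine hmain.trans ?_
  unfold PCS
  gcongr
  rw [← ENNReal.ofReal_add (Finset.sum_nonneg fun i _ => by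
    have := hδ0 i
    positivity) (by positivity)]
  refine ENNReal.ofReal_le_ofReal ?_
  have htail := sum_tail_le hK1 (by positivity : 0 ≤ 32 * centralMomentBound M ^ 2) hθ hβ2
    (sum_inv_cube_le hβ hβ2 k) hL hc0
  refine le_trans (le_of_eq ?_) htail
  congr 1
  rw [Finset.mul_sum, Finset.sum_mul]
  exact Finset.sum_congr rfl fun i _ => by ring

theorem tendsto_rpow_neg_succ {p : ℝ} (hp : 0 < p) :
    Tendsto (fun k : ℕ => ((k : ℝ) + 1) ^ (-p)) atTop (nhds 0) :=
  (tendsto_rpow_neg_atTop hp).comp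
    (tendsto_atTop_add_const_right _ _ tendsto_natCast_atTop_atTop)

theorem le_liminf_of_eventually_le_add {p : ENNReal} (hp : p ≠ ⊤) {u : ℕ → ENNReal} {e : ℕ → ℝ}
    (he : Tendsto e atTop (nhds 0)) (h : ∀ᶠ k in atTop, p ≤ u k + ENNReal.ofReal (e k)) :
    p ≤ liminf u atTop := by
  have h0 : Tendsto (fun k => p - ENNReal.ofReal (e k)) atTop (nhds p) := by
    have := ENNReal.Tendsto.sub (tendsto_const_nhds (x := p)) (ENNReal.tendsto_ofReal he)
      (Or.inl hp)
    simpa using this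
  rw [← h0.liminf_eq]
  exact liminf_le_liminf (h.mono fun k hk => tsub_le_iff_right.2 hk)

end Main

end MetaUCB

end

/-- The `k`-th problem has `k + 1` alternatives, labelled by `Fin (k + 1)`: the label `i` stands for
the alternative number `i + 1` among `k + 1`, so that `0` is the best one. -/
theorem proposition1 (q M α : ℝ) (hq : 3 < q) (hM : 0 < M) (hα : α ∈ Set.Ioo (0 : ℝ) 1) :
    ∃ d₀ d₁ d₂ d₃ : ℝ, 0 < d₀ ∧ 0 < d₁ ∧ 0 < d₂ ∧ 0 < d₃ ∧
      ∀ (β : ℝ), 0 ≤ β → β < min ((q - 3) / q) (1 / 2) →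
      ∀ (Ω : ℕ → Type*) [∀ k, MeasurableSpace (Ω k)]
        (P : ∀ k, Measure (Ω k)) [∀ k, IsProbabilityMeasure (P k)]
        (X : ∀ k, Fin (k + 1) → ℕ → Ω k → ℝ) (ν₁ : Measure ℝ) (μ₁ : ℝ)
        (rule out : ∀ k, MetaUCB.ArgmaxRule (Fin (k + 1))),
        (∀ k, MetaUCB.IsSamplingModel (P k) (X k)) →
        (∀ k, MetaUCB.MomentCondition (P k) (X k) q M) →
        (∀ k, (P k).map (X k 0 0) = ν₁) →
        (∀ k, ∫ ω, X k 0 0 ω ∂(P k) = μ₁) →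
        (∀ k, ∀ i : Fin (k + 1), i ≠ 0 →
          ∫ ω, X k i 0 ω ∂(P k) = μ₁ - (((i : ℝ) + 1) / ((k : ℝ) + 1)) ^ β) →
        ∀ m : ℕ,
          0 < P m {ω | (μ₁ : EReal) ≤
            MetaUCB.ucbInf (MetaUCB.bonus q M α 2) (fun j => X m 0 j ω)} ∧
          P m {ω | (μ₁ : EReal) ≤
              MetaUCB.ucbInf (MetaUCB.bonus q M α 2) (fun j => X m 0 j ω)} ≤
            liminf (fun k : ℕ =>
              MetaUCB.PCS (P k) (X k) (MetaUCB.bonus q M α 2) (rule k) (out k)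
                ((d₀ + d₁ / (1 - β * q / (q - 3)) + d₂ / (1 - 2 * β)
                  + d₃ * β / (1 - 2 * β) ^ 2) * ((k : ℝ) + 1)) 0) atTop := by
  have hq0 : 0 < q := by linarith
  have hq3 : 0 < q - 3 := by linarith
  obtain ⟨A, C, hA, hC, hf⟩ := MetaUCB.exists_bonus_le hq hM hα
  have hC0 : 0 < C := by linarith
  -- Four times the coefficients in `sum_sampleBound_le`: the budget is `4 * T`, where `T` bounds
  -- the expected overcounts. None depends on `β`.
  refine ⟨8, 4 * A, 4 * (C + 192 * MetaUCB.centralMomentBound M ^ 2), 16 * C, by norm_num,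
    by positivity, by positivity, by positivity, ?_⟩
  intro β hβ hβlt Ω _ P _ X ν₁ μ₁ rule out hX hm hν hmean₀ hmean m
  have hβ2 : β < 1 / 2 := hβlt.trans_le (min_le_right _ _)
  have hβq : β * (q / (q - 3)) < 1 := by
    have := hβlt.trans_le (min_le_left _ _)
    rw [lt_div_iff₀ hq0] at this
    rwa [← mul_div_assoc, div_lt_one hq3]
  have hνprob : IsProbabilityMeasure ν₁ := by
    rw [← hν m]
    exact Measure.isProbabilityMeasure_map ((hX m).measurable 0 0).aemeasurable
  have hobs := (hX m).isObservationSeq hq hM (hm m) 0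
  rw [hmean₀ m] at hobs
  simp only [MetaUCB.setOf_le_ucbInf]
  refine ⟨hobs.measure_le_ucb_pos (c := 3 / MetaUCB.a₂ q M)
    (div_pos (by norm_num) (MetaUCB.a₂_pos hq0 hM))
    (MetaUCB.sqrt_log_div_le_bonus hq0 hM hα), ?_⟩
  -- The first two lower bounds let `L` dominate every threshold, `2 / 3 * (1 + β) < θ` kills the
  -- union bound, and `θ < 1` kills the Chebyshev error.
  obtain ⟨θ, hθ, hθ1⟩ := exists_between
    (max_lt (max_lt hβq (by linarith : 2 * β < 1)) (by linarith : 2 / 3 * (1 + β) < 1))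
  obtain ⟨hθ, hθ₃⟩ := max_lt_iff.1 hθ
  obtain ⟨hθ₁, hθ₂⟩ := max_lt_iff.1 hθ
  set c : ℝ := 2 + A / (1 - β * (q / (q - 3)))
    + (C + 192 * MetaUCB.centralMomentBound M ^ 2) / (1 - 2 * β)
    + 4 * C * β / (1 - 2 * β) ^ 2 with hc
  have hB : ∀ k : ℕ, (8 + 4 * A / (1 - β * q / (q - 3))
      + 4 * (C + 192 * MetaUCB.centralMomentBound M ^ 2) / (1 - 2 * β)
      + 16 * C * β / (1 - 2 * β) ^ 2) * ((k : ℝ) + 1) = 4 * (c * ((k : ℝ) + 1)) := fun k => by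
    rw [hc, mul_div_assoc β q]; ring
  simp only [hB]
  refine MetaUCB.le_liminf_of_eventually_le_add (measure_ne_top _ _)
    (e := fun k : ℕ => 32 * MetaUCB.centralMomentBound M ^ 2 / (1 - 2 * β)
        * ((k : ℝ) + 1) ^ (-(3 / 2 * θ - (1 + β))) + 2 / c * ((k : ℝ) + 1) ^ (-(1 - θ))) ?_ ?_
  · have := ((MetaUCB.tendsto_rpow_neg_succ (p := 3 / 2 * θ - (1 + β)) (by linarith)).const_mul
      (32 * MetaUCB.centralMomentBound M ^ 2 / (1 - 2 * β))).add
      ((MetaUCB.tendsto_rpow_neg_succ (p := 1 - θ) (by linarith)).const_mul (2 / c))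
    simpa using this
  · have hev := (tendsto_atTop_add_const_right atTop (1 : ℝ)
      (tendsto_natCast_atTop_atTop (R := ℝ))).eventually
      (MetaUCB.eventually_le_rpow (A := A) hθ₁ hθ₂ hC0.le)
    filter_upwards [hev] with k hk
    -- The event moves from problem `m` to problem `k` through the common law `ν₁`.
    rw [(hX m).measure_le_ucb_eq 0 (hν m), ← (hX k).measure_le_ucb_eq 0 (hν k)]
    exact MetaUCB.measure_le_PCS_add hq hM hA hC hf hβ hβq hβ2 (by linarith) hk (hX k) (hm k)
      (hmean k) (rule k) (out k) hc
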